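/- Let $m,n\in\mathbb N$. Let $\mathcal M_m^n$ be the set of $n$-tuples $M=(M_1,\dots,M_n)$ of real symmetric $m\times m$ matrices that are simultaneously diagonalizable, i.e. $M_i=Q\Lambda_iQ^\top$ for all $i$ with one orthogonal $Q$ and diagonal $\Lambda_i$. Let $\mathrm dM$ be the uniform (Riemannian volume) measure on $\mathcal M_m^n$ for the metric $\sum_i\operatorname{tr}(\mathrm dM_i^\top \mathrm dM_i)$, i.e. the Hausdorff measure of dimension $nm+\frac{m(m-1)}2$ for the Frobenius distance, normalized to agree with Lebesgue measure on Euclidean spaces. Put $QMQ^\top=(QM_1Q^\top,\dots,QM_nQ^\top)$. **Theorem (Weyl formula, type (B)).** There is a constant $C_{m,n}>0$ such that for every ($\mathrm dM$-a.e.) measurable $f:\mathcal M_m^n\to\mathbb R$ with $f(QMQ^\top)=f(M)$ for all orthogonal $Q$ and all $M\in\mathcal M_m^n$: $f$ is integrable if and only if $\Lambda\mapsto f(\Lambda)\prod_{1\le i<j\le m}\|\lambda_{\cdot j}-\lambda_{\cdot i}\|$ is Lebesgue integrable on $\mathbb R^{n\times m}$, and $$\int f(M)\,\mathrm dM=C_{m,n}\int_{\mathbb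 R^{n\times m}} f(\Lambda)\prod_{1\le i<j\le m}\|\lambda_{\cdot j}-\lambda_{\cdot i}\|\,\mathrm d\Lambda ,$$ where $\Lambda=(\Lambda_1,\dots,\Lambda_n)$, $\Lambda_i=\operatorname{diag}(\lambda_{i1},\dots,\lambda_{im})$, $\lambda_{\cdot j}=(\lambda_{1j},\dots,\lambda_{nj})$ and $\|\cdot\|$ is the Euclidean norm on $\mathbb R^n$. (Integrals of non-integrable functions are read as $0$, here and below.) **Corollary (type (E)).** Let $\mathrm dM$ be a Haar measure on the additive group of real symmetric $N\times N$ matrices. There is $C_N>0$ (depending only on $N$ and the normalization of $\mathrm dM$) such that for every ($\mathrm dM$-a.e.) measurable real function $f$ depending only on the eigenvalues of $M$ (with multiplicity), $$\int f(M)\,\mathrm dM=C_N\int_{\mathbb R^N} f(\operatorname{diag}(\lambda_1,\dots,\lambda_N))\prod_{1\le j<k\le N}|\lambda_j-\lambda_k|\,\mathrm d\lambda_1\cdots \mathrm d\lambda_N ,$$ and one integrand is integrable if and only if the other is. **Corollary (type (C)).** Let $\mathrm dM$ be a Haar measure on the additive group of real symmetric $mn\times mn$ matrices that are block-diagonal with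 $n$ blocks of size $m\times m$. There is $C_{m,n}>0$ (depending only on $m,n$ and the normalization of $\mathrm dM$) such that for every ($\mathrm dM$-a.e.) measurable real function $f$ depending only on the eigenvalues (with multiplicity) of the $n$ blocks, $$\int f(M)\,\mathrm dM=C_{m,n}\int_{\mathbb R^{n\times m}} f(\Lambda)\prod_{i=1}^n\prod_{1\le j<k\le m}|\lambda_{ij}-\lambda_{ik}|\,\mathrm d\Lambda ,$$ where $\Lambda$ is the block-diagonal matrix with blocks $\operatorname{diag}(\lambda_{i1},\dots,\lambda_{im})$, $i=1,\dots,n$, and one integrand is integrable if and only if the other is. -/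

import Mathlib

open MeasureTheory

namespace WeylFormula

noncomputable section

/-- The Euclidean space of `n`-tuples of real `m × m` matrices; the entry at `(i, j, k)` is the
`(j, k)` entry of the `i`-th matrix. Its norm is the Frobenius norm
`(∑ i, tr (M i ᵀ * M i)) ^ (1 / 2)`. -/
abbrev TupleSpace (m n : ℕ) : Type :=
  EuclideanSpace ℝ (Fin n × Fin m × Fin m)

/-- The `i`-th matrix of a tuple. -/
def mat {m n : ℕ} (M : TupleSpace m n) (i : Fin n) : Matrix (Fin m) (Fin m) ℝ :=
  Matrix.of fun j k => M (i, j, k)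

/-- The tuple with the given matrices. -/
def ofMats {m n : ℕ} (A : Fin n → Matrix (Fin m) (Fin m) ℝ) : TupleSpace m n :=
  WithLp.toLp 2 fun p => A p.1 p.2.1 p.2.2

@[simp] theorem mat_ofMats {m n : ℕ} (A : Fin n → Matrix (Fin m) (Fin m) ℝ) (i : Fin n) :
    mat (ofMats A) i = A i := rfl

/-- The `n`-tuples of symmetric `m × m` matrices that are simultaneously diagonalizable:
`M i = Q * diagonal (l i) * Qᵀ` for all `i`, with one orthogonal matrix `Q`. -/
def simDiag (m n : ℕ) : Set (TupleSpace m n) :=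
  {M | ∃ Q ∈ Matrix.orthogonalGroup (Fin m) ℝ, ∃ l : Fin n → Fin m → ℝ,
    ∀ i, mat M i = Q * Matrix.diagonal (l i) * Q.transpose}

/-- The dimension of the space of simultaneously diagonalizable tuples: `n * m` joint eigenvalues
and `m * (m - 1) / 2` parameters for the orthogonal matrix. -/
def simDiagDim (m n : ℕ) : ℕ := n * m + m.choose 2

/-- The Riemannian volume on the space of simultaneously diagonalizable tuples, for the metric
`∑ i, tr (dM i ᵀ * dM i)` induced by the Frobenius inner product: the Hausdorff measure of dimension
`simDiagDim m n`, normalized so that it is Lebesgue measure on Euclidean spaces. -/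
def simDiagVolume (m n : ℕ) : Measure (simDiag m n) :=
  Measure.euclideanHausdorffMeasure (simDiagDim m n)

/-- The tuple `(Q * M 1 * Qᵀ, …, Q * M n * Qᵀ)`. -/
def conj {m n : ℕ} (Q : Matrix.orthogonalGroup (Fin m) ℝ) (M : simDiag m n) : simDiag m n :=
  ⟨ofMats fun i => (Q : Matrix (Fin m) (Fin m) ℝ) * mat M.1 i *
      (Q : Matrix (Fin m) (Fin m) ℝ).transpose, by
    obtain ⟨M, P, hP, l, h⟩ := M
    refine ⟨Q * P, mul_mem Q.2 hP, l, fun i => ?_⟩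
    simp only [mat_ofMats, h, Matrix.transpose_mul, Matrix.mul_assoc]⟩

/-- The tuple of diagonal matrices with diagonals `l 1, …, l n`. -/
def diagTuple {m n : ℕ} (l : Fin n → Fin m → ℝ) : simDiag m n :=
  ⟨ofMats fun i => Matrix.diagonal (l i), 1, one_mem _, l, fun i => by simp⟩

/-- The product over `j < k` of the Euclidean distances in `ℝⁿ` between the joint eigenvalues
`(l 1 j, …, l n j)` and `(l 1 k, …, l n k)`. -/
def jointVandermonde {m n : ℕ} (l : Fin n → Fin m → ℝ) : ℝ :=
  ∏ p : Fin m × Fin m with p.1 < p.2,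
    ‖(WithLp.toLp 2 fun i => l i p.2 - l i p.1 : EuclideanSpace ℝ (Fin n))‖

/-- The real vector space of symmetric `N × N` matrices. -/
def symSpace (N : ℕ) : Submodule ℝ (Matrix (Fin N) (Fin N) ℝ) where
  carrier := {A | A.IsSymm}
  add_mem' ha hb := ha.add hb
  zero_mem' := Matrix.isSymm_zero
  smul_mem' c _ ha := ha.smul c

instance (N : ℕ) : MeasurableSpace (symSpace N) := borel _

instance (N : ℕ) : BorelSpace (symSpace N) := ⟨rfl⟩

/-- The diagonal matrix with diagonal `l`, as a symmetric matrix. -/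
def symDiagonal {N : ℕ} (l : Fin N → ℝ) : symSpace N :=
  ⟨Matrix.diagonal l, Matrix.isSymm_diagonal l⟩

/-- The real vector space of symmetric `(m * n) × (m * n)` matrices that are block-diagonal with
`n` blocks of size `m × m`. Rows and columns are indexed by pairs (place in the block, block). -/
def blockSymSpace (m n : ℕ) : Submodule ℝ (Matrix (Fin m × Fin n) (Fin m × Fin n) ℝ) where
  carrier := {A | A.IsSymm ∧ ∀ p q, p.2 ≠ q.2 → A p q = 0}
  add_mem' ha hb := ⟨ha.1.add hb.1, fun p q h => by simp [ha.2 p q h, hb.2 p q h]⟩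
  zero_mem' := ⟨Matrix.isSymm_zero, fun _ _ _ => rfl⟩
  smul_mem' c _ ha := ⟨ha.1.smul c, fun p q h => by simp [ha.2 p q h]⟩

instance (m n : ℕ) : MeasurableSpace (blockSymSpace m n) := borel _

instance (m n : ℕ) : BorelSpace (blockSymSpace m n) := ⟨rfl⟩

/-- The diagonal matrix whose `i`-th block has diagonal `l i`. -/
def blockSymDiagonal {m n : ℕ} (l : Fin n → Fin m → ℝ) : blockSymSpace m n :=
  ⟨Matrix.diagonal fun p => l p.2 p.1, Matrix.isSymm_diagonal _, fun _ _ h =>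
    Matrix.diagonal_apply_ne _ fun hpq => h (congrArg Prod.snd hpq)⟩

end

end WeylFormula

/-!
The Weyl formulas come from one identity of measures. Let `frameVolume` be the volume of the space
of pairs `(Q, l)` with `Q` an orthogonal `m × m` matrix and `l` a family of `n` vectors of joint
eigenvalues, and let `spectralMap` send `(Q, l)` to the tuple of `Q * diagonal (l i) * Qᵀ`. Then
the image of `frameVolume`, weighted by `jointVandermonde l`, is `2 ^ m * m!` times the volume of
the simultaneously diagonalizable tuples (`map_spectralMap_weightedFrameVolume`).

The Jacobian. At `Q = 1`, an infinitesimal rotation in the plane of the `j`-th and `k`-th axes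
moves the tuple of diagonal matrices with a speed proportional to the distance between the `j`-th
and the `k`-th joint eigenvalue, and these directions are orthogonal to each other and to the
diagonal tuples (`norm_spectralDeriv_chartDeriv`). Near a point, a strictly differentiable map
distorts distances like its derivative, up to a factor `K` close to `1`, so that the Hausdorff
measure of images is given by the Jacobian up to a power of `K`
(`exists_nhds_euclideanHausdorffMeasure_image`). Applying this to the Cayley parametrization of
the orthogonal group and to its composition with `spectralMap`, and dividing, one obtains that
`spectralMap` has Jacobian `jointVandermonde l` at `(1, l)`; other frames are reduced to `Q = 1`
by rotations, which are isometries on both sides (`exists_nhds_spectralMap_comparison`).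

From local to global. The tuples with a multiple joint eigenvalue form a null set, being the image
of a null set under a smooth map (`euclideanHausdorffMeasure_singularTuples`). Over any other
tuple the fibre is an orbit of the `2 ^ m * m!` signed permutations of the eigenvectors
(`exists_eq_signedPerm`), which act by isometries. Two measures which agree near every point up to
factors arbitrarily close to `1` are equal, by a countable covering (`measure_le_of_forall_nhds`).

Integration. As `frameVolume` is invariant under translations of `l`, uniqueness of Haar measure
makes it a product of a finite measure on orthogonal matrices with Lebesgue measure
(`map_frameCoords_frameVolume`). An invariant function depends on `l` only, and integrating out
`Q` gives the formula for simultaneously diagonalizable tuples. For `n = 1` all symmetric matrices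
are diagonalizable, and the Hausdorff measure is translation invariant, hence a Haar measure
(`exists_isAddHaarMeasure_map_symOfCoords`); products of such measures give the Haar measure on
block-diagonal matrices. Uniqueness of Haar measure accounts for the normalization.
-/

namespace WeylFormula

noncomputable section

open Set Filter Topology
open scoped NNReal ENNReal

/-! ### Comparison of Hausdorff measures -/

/-- If two maps `f`, `g` on a common domain satisfy `dist (f x) (f y) ≤ K * dist (g x) (g y)` on
`B`, then `g x ↦ f x` is a well-defined `K`-Lipschitz map from `g '' B` onto `f '' B`. -/
theorem euclideanHausdorffMeasure_image_le_of_dist_le {α X Y : Type*}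
    [MetricSpace X] [MeasurableSpace X] [BorelSpace X]
    [MetricSpace Y] [MeasurableSpace Y] [BorelSpace Y]
    {f : α → X} {g : α → Y} {B : Set α} {K : ℝ≥0} (d : ℕ)
    (h : ∀ x ∈ B, ∀ y ∈ B, dist (f x) (f y) ≤ K * dist (g x) (g y)) :
    μHE[d] (f '' B) ≤ (K : ℝ≥0∞) ^ d * μHE[d] (g '' B) := by
  rcases isEmpty_or_nonempty α with hα | hα
  · simp [Set.eq_empty_of_isEmpty B]
  have key : ∀ y ∈ g '' B, Function.invFunOn g B y ∈ B ∧ g (Function.invFunOn g B y) = y :=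
    fun y hy => ⟨Function.invFunOn_mem hy, Function.invFunOn_eq hy⟩
  have hL : LipschitzOnWith K (f ∘ Function.invFunOn g B) (g '' B) := by
    refine LipschitzOnWith.of_dist_le_mul fun x hx y hy => ?_
    have := h _ (key x hx).1 _ (key y hy).1
    rwa [(key x hx).2, (key y hy).2] at this
  have himg : (f ∘ Function.invFunOn g B) '' (g '' B) = f '' B := by
    apply Subset.antisymm
    · rintro _ ⟨y, hy, rfl⟩
      exact ⟨_, (key y hy).1, rfl⟩
    · rintro _ ⟨x, hx, rfl⟩
      refine ⟨g x, ⟨x, hx, rfl⟩, ?_⟩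
      have hk := key (g x) ⟨x, hx, rfl⟩
      have := h _ hk.1 _ hx
      rw [hk.2, dist_self, mul_zero] at this
      exact dist_le_zero.1 this
  have := hL.hausdorffMeasure_image_le (d := d) (by positivity)
  rw [himg, ENNReal.rpow_natCast] at this
  simp only [Measure.euclideanHausdorffMeasure_def, Measure.smul_apply]
  rw [ENNReal.smul_def, ENNReal.smul_def, smul_eq_mul, smul_eq_mul, mul_left_comm]
  gcongr

/-- Infinitesimal bi-Lipschitz comparison: near `x₀`, a strictly differentiable map with derivative
`L` distorts distances like any injective linear map `D` with `‖L v‖ = ‖D v‖`, up to a factor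
arbitrarily close to `1`. -/
theorem exists_nhds_dist_le_mul_dist {E F G : Type*} [NormedAddCommGroup E] [NormedSpace ℝ E]
    [FiniteDimensional ℝ E] [NormedAddCommGroup F] [NormedSpace ℝ F]
    [NormedAddCommGroup G] [NormedSpace ℝ G]
    {φ : E → F} {L : E →L[ℝ] F} {x₀ : E} (hφ : HasStrictFDerivAt φ L x₀)
    (D : E →ₗ[ℝ] G) (hD : ∀ v, ‖L v‖ = ‖D v‖) (hinj : Function.Injective D)
    {K : ℝ≥0} (hK : 1 < K) :
    ∃ U ∈ 𝓝 x₀, ∀ x ∈ U, ∀ y ∈ U, dist (φ x) (φ y) ≤ K * dist (D x) (D y) ∧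
      dist (D x) (D y) ≤ K * dist (φ x) (φ y) := by
  obtain ⟨c, hc, hcD⟩ := LinearMap.exists_antilipschitzWith D (LinearMap.ker_eq_bot.2 hinj)
  have hK1 : (1 : ℝ) < K := by exact_mod_cast hK
  have hc' : (0 : ℝ) < c := by exact_mod_cast hc
  have hcD' : ∀ v, ‖v‖ ≤ c * ‖D v‖ := fun v => by
    simpa [dist_eq_norm] using hcD.le_mul_dist v 0
  -- the error `δ * ‖x - y‖` has to be at most `(1 - K⁻¹) * ‖D (x - y)‖`, and `1 + (1 - K⁻¹) ≤ K`
  set δ : ℝ := (1 - (K : ℝ)⁻¹) / c with hδ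
  have hKi : (K : ℝ)⁻¹ < 1 := inv_lt_one_of_one_lt₀ hK1
  have hδ0 : 0 < δ := div_pos (by linarith) hc'
  have hev := hφ.isLittleO.bound hδ0
  rw [nhds_prod_eq] at hev
  obtain ⟨U, hU, hUs⟩ := Filter.mem_prod_same_iff.1 hev
  refine ⟨U, hU, fun x hx y hy => ?_⟩
  have h := hUs (mk_mem_prod hx hy)
  simp only [mem_ofPred_eq] at h
  have h2 : ‖φ x - φ y - L (x - y)‖ ≤ (1 - (K : ℝ)⁻¹) * ‖D (x - y)‖ := by
    refine h.trans ?_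
    calc δ * ‖x - y‖ ≤ δ * (c * ‖D (x - y)‖) := by gcongr; exact hcD' _
      _ = _ := by rw [hδ]; field_simp
  rw [dist_eq_norm, dist_eq_norm, ← map_sub]
  have h3 : ‖φ x - φ y‖ ≤ ‖φ x - φ y - L (x - y)‖ + ‖L (x - y)‖ := by
    simpa using norm_add_le (φ x - φ y - L (x - y)) (L (x - y))
  have h4 : ‖L (x - y)‖ ≤ ‖φ x - φ y - L (x - y)‖ + ‖φ x - φ y‖ := by
    have := norm_sub_le (φ x - φ y) (φ x - φ y - L (x - y))
    rw [sub_sub_cancel] at this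
    linarith
  rw [hD] at h3 h4
  set t := ‖D (x - y)‖
  have ht : 0 ≤ t := norm_nonneg _
  have hKK : (K : ℝ) * (K : ℝ)⁻¹ = 1 := mul_inv_cancel₀ (by linarith)
  constructor
  · have : 2 - (K : ℝ)⁻¹ ≤ K := by
      have : 0 ≤ ((K : ℝ) - 1) * (1 - (K : ℝ)⁻¹) := mul_nonneg (by linarith) (by linarith)
      nlinarith
    nlinarith [mul_le_mul_of_nonneg_right this ht]
  · have h5 : (K : ℝ)⁻¹ * t ≤ ‖φ x - φ y‖ := by linarith
    calc t = K * ((K : ℝ)⁻¹ * t) := by rw [← mul_assoc, hKK, one_mul]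
      _ ≤ _ := by gcongr

/-- The infinitesimal area formula: near `x₀`, the Hausdorff measure of images under a strictly
differentiable map is Lebesgue measure times a Jacobian, up to a factor arbitrarily close to `1`. -/
theorem exists_nhds_euclideanHausdorffMeasure_image {E F : Type*}
    [NormedAddCommGroup E] [InnerProductSpace ℝ E] [FiniteDimensional ℝ E] [MeasurableSpace E]
    [BorelSpace E] [NormedAddCommGroup F] [NormedSpace ℝ F] [MeasurableSpace F] [BorelSpace F]
    {φ : E → F} {L : E →L[ℝ] F} {x₀ : E} (hφ : HasStrictFDerivAt φ L x₀)
    (D : E →ₗ[ℝ] E) (hD : ∀ v, ‖L v‖ = ‖D v‖) (hdet : LinearMap.det D ≠ 0)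
    {d : ℕ} (hd : Module.finrank ℝ E = d) {K : ℝ≥0} (hK : 1 < K) :
    ∃ U ∈ 𝓝 x₀, InjOn φ U ∧ ∀ B ⊆ U,
      μHE[d] (φ '' B) ≤ (K : ℝ≥0∞) ^ d * (ENNReal.ofReal |LinearMap.det D| * volume B) ∧
      ENNReal.ofReal |LinearMap.det D| * volume B ≤ (K : ℝ≥0∞) ^ d * μHE[d] (φ '' B) := by
  have hinj : Function.Injective D :=
    (LinearMap.equivOfDetNeZero D hdet).injective
  obtain ⟨U, hU, h⟩ := exists_nhds_dist_le_mul_dist hφ D hD hinj hK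
  have hvol : ∀ B : Set E, μHE[d] (D '' B) = ENNReal.ofReal |LinearMap.det D| * volume B := by
    intro B
    subst hd
    rw [InnerProductSpace.euclideanHausdorffMeasure_eq_volume, Measure.addHaar_image_linearMap]
  refine ⟨U, hU, fun x hx y hy hxy => hinj ?_, fun B hB => ?_⟩
  · have := (h x hx y hy).2
    rw [hxy, dist_self, mul_zero] at this
    exact dist_le_zero.1 this
  · rw [← hvol]
    exact ⟨euclideanHausdorffMeasure_image_le_of_dist_le d
        fun x hx y hy => (h x (hB hx) y (hB hy)).1,
      euclideanHausdorffMeasure_image_le_of_dist_le d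
        fun x hx y hy => (h x (hB hx) y (hB hy)).2⟩

/-- A continuously differentiable map sends null sets of a Hausdorff measure to null sets. -/
theorem euclideanHausdorffMeasure_image_eq_zero {E F : Type*} [NormedAddCommGroup E]
    [NormedSpace ℝ E] [FiniteDimensional ℝ E] [MeasurableSpace E] [BorelSpace E]
    [NormedAddCommGroup F] [NormedSpace ℝ F]
    [MeasurableSpace F] [BorelSpace F] {φ : E → F} (hφ : ContDiff ℝ 1 φ) {d : ℕ} {N : Set E}
    (hN : μHE[d] N = 0) : μHE[d] (φ '' N) = 0 := by
  have : ∀ x : E, ∃ U ∈ 𝓝 x, ∃ K : ℝ≥0, LipschitzOnWith K φ U := fun x => by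
    obtain ⟨K, U, hU, h⟩ := (hφ.contDiffAt (x := x)).exists_lipschitzOnWith
    exact ⟨U, hU, K, h⟩
  choose U hU K hK using this
  obtain ⟨t, -, htc, ht⟩ := TopologicalSpace.countable_cover_nhdsWithin (s := N) (f := U)
    fun x _ => mem_nhdsWithin_of_mem_nhds (hU x)
  have hsub : φ '' N ⊆ ⋃ x ∈ t, φ '' (N ∩ U x) := by
    rintro _ ⟨y, hy, rfl⟩
    obtain ⟨x, hx, hyx⟩ := mem_iUnion₂.1 (ht hy)
    exact mem_iUnion₂.2 ⟨x, hx, y, ⟨hy, hyx⟩, rfl⟩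
  refine measure_mono_null hsub ((measure_biUnion_null_iff htc).2 fun x _ => ?_)
  have h1 := euclideanHausdorffMeasure_image_le_of_dist_le (f := φ) (g := (id : E → E))
    (B := N ∩ U x) (K := K x) d fun y hy z hz => (hK x).dist_le_mul y hy.2 z hz.2
  rw [image_id, measure_mono_null inter_subset_left hN, mul_zero] at h1
  exact le_antisymm h1 zero_le

/-! ### Measures that agree infinitesimally -/

theorem le_of_forall_one_lt_le_pow_mul {a b : ℝ≥0∞} (p : ℕ)
    (h : ∀ K : ℝ≥0, 1 < K → a ≤ (K : ℝ≥0∞) ^ p * b) : a ≤ b := by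
  have hK : Tendsto (fun K : ℝ≥0 => (K : ℝ≥0∞) ^ p * b) (𝓝[>] 1) (𝓝 (1 * b)) := by
    refine ENNReal.Tendsto.mul_const ?_ (Or.inl one_ne_zero)
    have : Tendsto (fun K : ℝ≥0 => (K : ℝ≥0∞) ^ p) (𝓝 1) (𝓝 (((1 : ℝ≥0) : ℝ≥0∞) ^ p)) :=
      ((ENNReal.continuous_pow p).comp ENNReal.continuous_coe).tendsto 1
    simpa using this.mono_left nhdsWithin_le_nhds
  rw [one_mul] at hK
  have : (𝓝[>] (1 : ℝ≥0)).NeBot := inferInstance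
  exact ge_of_tendsto hK (eventually_mem_nhdsWithin.mono fun K hK => h K hK)

/-- An inequality between measures on the pieces of a countable cover holds on its union. -/
theorem measure_le_mul_of_iUnion {Y ι : Type*} [MeasurableSpace Y] [Countable ι] {μ₁ μ₂ : Measure Y}
    {c : ℝ≥0∞} {A : ι → Set Y} (hA : ∀ i, MeasurableSet (A i))
    (h : ∀ i, ∀ B ⊆ A i, MeasurableSet B → μ₁ B ≤ c * μ₂ B) {B : Set Y} (hB : MeasurableSet B)
    (hBA : B ⊆ ⋃ i, A i) : μ₁ B ≤ c * μ₂ B := by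
  rcases isEmpty_or_nonempty ι with hι | hι
  · have : B = ∅ := by simpa [subset_empty_iff] using hBA
    simp [this]
  obtain ⟨e, he⟩ := exists_surjective_nat ι
  set A' : ℕ → Set Y := fun k => B ∩ disjointed (fun k => A (e k)) k
  have hm : ∀ k, MeasurableSet (A' k) := fun k =>
    hB.inter (MeasurableSet.disjointed (fun k => hA (e k)) k)
  have hd : Pairwise (Function.onFun Disjoint A') := fun i j hij =>
    (disjoint_disjointed _ hij).mono inter_subset_right inter_subset_right
  have hU : B = ⋃ k, A' k := by
    rw [← inter_iUnion, iUnion_disjointed, he.iUnion_comp A, inter_eq_left.2 hBA]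
  calc μ₁ B = ∑' k, μ₁ (A' k) := by rw [← measure_iUnion hd hm, ← hU]
    _ ≤ ∑' k, c * μ₂ (A' k) := ENNReal.tsum_le_tsum fun k =>
      h (e k) _ (inter_subset_right.trans (disjointed_subset _ _)) (hm k)
    _ = c * μ₂ B := by rw [ENNReal.tsum_mul_left, ← measure_iUnion hd hm, ← hU]

/-- Let the measures `μ₁`, `μ₂` live on the image of a continuous map `Φ`. If near every point of
`C ∩ G` the inequality `μ₁ ≤ μ₂` holds up to a factor arbitrarily close to `1` on images under `Φ`,
then it holds on `Φ '' (C ∩ G)`. -/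
theorem measure_le_of_forall_nhds {Z Y : Type*} [TopologicalSpace Z] [SecondCountableTopology Z]
    [LocallyCompactSpace Z] [TopologicalSpace Y] [T2Space Y] [MeasurableSpace Y]
    [OpensMeasurableSpace Y] {Φ : Z → Y} (hΦ : Continuous Φ) {C G : Set Z} (hC : IsClosed C)
    {μ₁ μ₂ : Measure Y} (p : ℕ)
    (h : ∀ z ∈ C ∩ G, ∀ K : ℝ≥0, 1 < K → ∃ U ∈ 𝓝 z, ∀ B ⊆ Φ '' (U ∩ C), MeasurableSet B →
      μ₁ B ≤ (K : ℝ≥0∞) ^ p * μ₂ B) {B : Set Y} (hB : MeasurableSet B) (hBs : B ⊆ Φ '' (C ∩ G)) :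
    μ₁ B ≤ μ₂ B := by
  refine le_of_forall_one_lt_le_pow_mul p fun K hK => ?_
  have h' : ∀ z : Z, ∃ U : Set Z, IsCompact U ∧ (z ∈ C ∩ G → U ∈ 𝓝 z ∧
      ∀ B ⊆ Φ '' (U ∩ C), MeasurableSet B → μ₁ B ≤ (K : ℝ≥0∞) ^ p * μ₂ B) := by
    intro z
    by_cases hz : z ∈ C ∩ G
    · obtain ⟨U, hU, hUB⟩ := h z hz K hK
      obtain ⟨U', hU', hsub, hc⟩ := local_compact_nhds hU
      exact ⟨U', hc, fun _ => ⟨hU', fun B hB =>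
        hUB B (hB.trans (image_mono (inter_subset_inter_left _ hsub)))⟩⟩
    · exact ⟨∅, isCompact_empty, fun h => absurd h hz⟩
  choose U hUc hU using h'
  obtain ⟨t, hts, htc, ht⟩ := TopologicalSpace.countable_cover_nhdsWithin (s := C ∩ G) (f := U)
    fun z hz => mem_nhdsWithin_of_mem_nhds (hU z hz).1
  have := htc.to_subtype
  refine measure_le_mul_of_iUnion (ι := t) (A := fun z => Φ '' (U z ∩ C)) (fun z =>
    (((hUc z).inter_right hC).image hΦ).isClosed.measurableSet)
    (fun z => (hU z (hts z.2)).2) hB fun y hy => ?_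
  obtain ⟨z, hz, rfl⟩ := hBs hy
  obtain ⟨x, hx, hzx⟩ := mem_iUnion₂.1 (ht hz)
  exact mem_iUnion.2 ⟨⟨x, hx⟩, z, ⟨hzx, hz.1⟩, rfl⟩

/-! ### Integration of functions invariant along a factor -/

/-- If a measure is the image of a product measure `ν × ξ` under `Ψ`, then functions which along `Ψ`
depend on the second factor only are integrated by integrating over `ξ`. -/
theorem integrable_iff_and_integral_eq_of_map_prod {X T Y : Type*} [MeasurableSpace X]
    [MeasurableSpace T] [MeasurableSpace Y] {μ : Measure X} {ν : Measure T} {ξ : Measure Y}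
    [IsFiniteMeasure ν] [SFinite ξ] (hν : ν ≠ 0) {Ψ : T × Y → X} (hΨ : AEMeasurable Ψ (ν.prod ξ))
    (hμ : μ = (ν.prod ξ).map Ψ) {f : X → ℝ} (hf : AEMeasurable f μ) {g : Y → ℝ}
    (hfg : ∀ᵐ p ∂(ν.prod ξ), f (Ψ p) = g p.2) :
    (Integrable f μ ↔ Integrable g ξ) ∧ ∫ x, f x ∂μ = ν.real univ * ∫ y, g y ∂ξ := by
  subst hμ
  constructor
  · rw [integrable_map_measure hf.aestronglyMeasurable hΨ, ← Integrable.comp_snd_iff (f := g) hν]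
    exact integrable_congr hfg
  · rw [integral_map hΨ hf.aestronglyMeasurable, integral_congr_ae hfg, integral_fun_snd,
      smul_eq_mul]

/-- Integrals against a measure with a real density. -/
theorem integrable_withDensity_ofReal_iff {Y : Type*} [MeasurableSpace Y] {ξ : Measure Y}
    {w : Y → ℝ} (hw : Measurable w) (hw0 : ∀ y, 0 ≤ w y) (g : Y → ℝ) :
    (Integrable g (ξ.withDensity fun y => ENNReal.ofReal (w y)) ↔
      Integrable (fun y => g y * w y) ξ) ∧
    ∫ y, g y ∂(ξ.withDensity fun y => ENNReal.ofReal (w y)) = ∫ y, g y * w y ∂ξ := by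
  constructor
  · rw [integrable_withDensity_iff hw.ennreal_ofReal (by simp)]
    simp only [ENNReal.toReal_ofReal (hw0 _)]
  · rw [integral_withDensity_eq_integral_toReal_smul hw.ennreal_ofReal (by simp)]
    simp only [ENNReal.toReal_ofReal (hw0 _), smul_eq_mul, mul_comm]

theorem lintegral_pi_fin_prod {Y : Type*} [MeasurableSpace Y] {n : ℕ} (ξ : Fin n → Measure Y)
    [∀ i, SigmaFinite (ξ i)] {w : Y → ℝ≥0∞} (hw : Measurable w) :
    ∫⁻ y, ∏ i, w (y i) ∂(Measure.pi ξ) = ∏ i, ∫⁻ y, w y ∂(ξ i) := by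
  induction n with
  | zero => simp
  | succ n ih =>
    calc _ = ∫⁻ x : Y × (Fin n → Y), w x.1 * ∏ i, w (x.2 i)
          ∂((ξ 0).prod (Measure.pi fun i => ξ i.succ)) := by
          rw [← (measurePreserving_piFinSuccAbove ξ 0).symm.lintegral_comp
            (f := fun y => ∏ i, w (y i)) (by fun_prop)]
          simp only [MeasurableEquiv.piFinSuccAbove_symm_apply, Fin.insertNthEquiv,
            Equiv.coe_fn_mk, Fin.insertNth_zero', Fin.prod_univ_succ, Fin.cons_zero,
            Fin.cons_succ, Fin.zero_succAbove]
      _ = (∫⁻ y, w y ∂(ξ 0)) * ∏ i : Fin n, ∫⁻ y, w y ∂(ξ i.succ) := by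
          rw [← ih fun i => ξ i.succ]
          exact lintegral_prod_mul (g := fun y : Fin n → Y => ∏ i, w (y i)) hw.aemeasurable
            (Measurable.aemeasurable (by fun_prop))
      _ = _ := by rw [Fin.prod_univ_succ]

/-- A product of measures with density is the product measure with the product density. -/
theorem pi_withDensity {n : ℕ} {Y : Type*} [MeasurableSpace Y] {ξ : Measure Y}
    [SigmaFinite ξ] {w : Y → ℝ≥0∞} (hw : Measurable w) [SigmaFinite (ξ.withDensity w)] :
    Measure.pi (fun _ : Fin n => ξ.withDensity w) =
      (Measure.pi fun _ : Fin n => ξ).withDensity fun y => ∏ i, w (y i) := by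
  refine Measure.pi_eq fun s hs => ?_
  rw [withDensity_apply _ (MeasurableSet.univ_pi hs), Measure.restrict_pi_pi,
    lintegral_pi_fin_prod _ hw]
  exact Finset.prod_congr rfl fun i _ => (withDensity_apply _ (hs i)).symm

/-! ### Spectral coordinates -/

/-- Pairs `(Q, l)` of an `m × m` matrix `Q` and a family `l` of `n` vectors in `ℝᵐ`, as a Euclidean
space. -/
abbrev FrameSpace (m n : ℕ) : Type :=
  EuclideanSpace ℝ ((Fin m × Fin m) ⊕ (Fin n × Fin m))

/-- The matrix component. -/
def frame {m n : ℕ} (z : FrameSpace m n) : Matrix (Fin m) (Fin m) ℝ :=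
  Matrix.of fun j k => z (Sum.inl (j, k))

/-- The component of joint eigenvalues. -/
def eigs {m n : ℕ} (z : FrameSpace m n) : Fin n → Fin m → ℝ :=
  fun i j => z (Sum.inr (i, j))

/-- The point with given components. -/
def mkFrame {m n : ℕ} (Q : Matrix (Fin m) (Fin m) ℝ) (l : Fin n → Fin m → ℝ) : FrameSpace m n :=
  WithLp.toLp 2 (Sum.elim (fun p => Q p.1 p.2) (fun p => l p.1 p.2))

@[simp] theorem frame_mkFrame {m n : ℕ} (Q : Matrix (Fin m) (Fin m) ℝ) (l : Fin n → Fin m → ℝ) :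
    frame (mkFrame Q l) = Q := rfl

@[simp] theorem eigs_mkFrame {m n : ℕ} (Q : Matrix (Fin m) (Fin m) ℝ) (l : Fin n → Fin m → ℝ) :
    eigs (mkFrame Q l) = l := rfl

@[simp] theorem mkFrame_frame_eigs {m n : ℕ} (z : FrameSpace m n) :
    mkFrame (frame z) (eigs z) = z := by
  ext (p | p) <;> rfl

theorem frameSpace_ext {m n : ℕ} {z w : FrameSpace m n} (h₁ : frame z = frame w)
    (h₂ : eigs z = eigs w) : z = w := by
  rw [← mkFrame_frame_eigs z, ← mkFrame_frame_eigs w, h₁, h₂]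

/-- The tuple `(Q * diagonal (l i) * Qᵀ)_i` with frame `Q` and joint eigenvalues `l`. -/
def spectralMap {m n : ℕ} (z : FrameSpace m n) : TupleSpace m n :=
  ofMats fun i => frame z * Matrix.diagonal (eigs z i) * (frame z).transpose

theorem spectralMap_apply {m n : ℕ} (z : FrameSpace m n) (i : Fin n) (j k : Fin m) :
    spectralMap z (i, j, k) = ∑ a, frame z j a * eigs z i a * frame z k a := by
  simp [spectralMap, ofMats, Matrix.mul_apply, Matrix.diagonal_apply]

theorem contDiff_spectralMap (m n : ℕ) :
    ContDiff ℝ 1 (spectralMap : FrameSpace m n → TupleSpace m n) := by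
  rw [contDiff_euclidean]
  rintro ⟨i, j, k⟩
  simp only [spectralMap_apply]
  simp only [frame, eigs, Matrix.of_apply]
  fun_prop

theorem continuous_frame (m n : ℕ) :
    Continuous (frame : FrameSpace m n → Matrix (Fin m) (Fin m) ℝ) := by
  refine continuous_matrix fun j k => ?_
  simp only [frame, Matrix.of_apply]
  fun_prop

theorem continuous_eigs (m n : ℕ) : Continuous (eigs : FrameSpace m n → Fin n → Fin m → ℝ) := by
  unfold eigs
  fun_prop

/-- The pairs `(Q, l)` with `Q` orthogonal. -/
def orthFrames (m n : ℕ) : Set (FrameSpace m n) :=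
  {z | frame z ∈ Matrix.orthogonalGroup (Fin m) ℝ}

theorem isClosed_orthFrames (m n : ℕ) : IsClosed (orthFrames m n) := by
  have : orthFrames m n = {z | frame z * (frame z).transpose = 1} := by
    ext z
    simp [orthFrames, Matrix.mem_orthogonalGroup_iff]
  rw [this]
  have := continuous_frame m n
  exact isClosed_eq (by fun_prop) continuous_const

theorem simDiag_eq_image (m n : ℕ) : simDiag m n = spectralMap '' orthFrames m n := by
  ext M
  constructor
  · rintro ⟨Q, hQ, l, h⟩
    refine ⟨mkFrame Q l, hQ, ?_⟩
    ext ⟨i, j, k⟩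
    exact (congrFun (congrFun (h i) j) k).symm
  · rintro ⟨z, hz, rfl⟩
    exact ⟨frame z, hz, eigs z, fun i => rfl⟩

/-! ### Symmetries -/

theorem transpose_mul_of_mem {m : ℕ} {Q : Matrix (Fin m) (Fin m) ℝ}
    (hQ : Q ∈ Matrix.orthogonalGroup (Fin m) ℝ) : Q.transpose * Q = 1 :=
  (Matrix.mem_orthogonalGroup_iff' _ _).1 hQ

theorem mul_transpose_of_mem {m : ℕ} {Q : Matrix (Fin m) (Fin m) ℝ}
    (hQ : Q ∈ Matrix.orthogonalGroup (Fin m) ℝ) : Q * Q.transpose = 1 :=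
  (Matrix.mem_orthogonalGroup_iff _ _).1 hQ

theorem mem_of_transpose_mul {m : ℕ} {Q : Matrix (Fin m) (Fin m) ℝ}
    (hQ : Q.transpose * Q = 1) : Q ∈ Matrix.orthogonalGroup (Fin m) ℝ :=
  (Matrix.mem_orthogonalGroup_iff' _ _).2 hQ

theorem sum_sq_orthogonal_mul {ι : Type*} [Fintype ι] {m : ℕ} {Q : Matrix (Fin m) (Fin m) ℝ}
    (hQ : Q ∈ Matrix.orthogonalGroup (Fin m) ℝ) (A : Matrix (Fin m) ι ℝ) :
    ∑ j, ∑ k, ((Q * A) j k) ^ 2 = ∑ j, ∑ k, (A j k) ^ 2 := by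
  classical
  have h : ∀ B : Matrix (Fin m) ι ℝ, ∑ j, ∑ k, (B j k) ^ 2 = (B.transpose * B).trace := fun B => by
    simp only [Matrix.trace, Matrix.diag, Matrix.mul_apply, Matrix.transpose_apply, sq]
    exact Finset.sum_comm
  rw [h, h, Matrix.transpose_mul, Matrix.mul_assoc, ← Matrix.mul_assoc _ Q, transpose_mul_of_mem hQ,
    Matrix.one_mul]

theorem transpose_mem {m : ℕ} {Q : Matrix (Fin m) (Fin m) ℝ}
    (hQ : Q ∈ Matrix.orthogonalGroup (Fin m) ℝ) :
    Q.transpose ∈ Matrix.orthogonalGroup (Fin m) ℝ :=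
  mem_of_transpose_mul (by rw [Matrix.transpose_transpose, mul_transpose_of_mem hQ])

theorem norm_sq_frameSpace {m n : ℕ} (z : FrameSpace m n) :
    ‖z‖ ^ 2 = ∑ j, ∑ k, (frame z j k) ^ 2 + ∑ i, ∑ j, (eigs z i j) ^ 2 := by
  rw [EuclideanSpace.norm_sq_eq, Fintype.sum_sum_type, Fintype.sum_prod_type, Fintype.sum_prod_type]
  simp [frame, eigs]

theorem norm_sq_tupleSpace {m n : ℕ} (M : TupleSpace m n) :
    ‖M‖ ^ 2 = ∑ i, ∑ j, ∑ k, (mat M i j k) ^ 2 := by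
  rw [EuclideanSpace.norm_sq_eq, Fintype.sum_prod_type]
  simp only [Fintype.sum_prod_type]
  simp [mat]

/-- Rotation of the frame by an orthogonal matrix from the left, as a linear isometry. -/
def rotateFrame {m n : ℕ} (Q : Matrix (Fin m) (Fin m) ℝ)
    (hQ : Q ∈ Matrix.orthogonalGroup (Fin m) ℝ) : FrameSpace m n →ₗᵢ[ℝ] FrameSpace m n where
  toFun z := mkFrame (Q * frame z) (eigs z)
  map_add' z w := frameSpace_ext
    (by
      change Q * (frame z + frame w) = Q * frame z + Q * frame w
      exact Matrix.mul_add _ _ _) rfl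
  map_smul' c z := frameSpace_ext
    (by
      change Q * (c • frame z) = c • (Q * frame z)
      exact Matrix.mul_smul _ _ _) rfl
  norm_map' z := by
    rw [← sq_eq_sq₀ (norm_nonneg _) (norm_nonneg _), norm_sq_frameSpace, norm_sq_frameSpace]
    change ∑ j, ∑ k, ((Q * frame z) j k) ^ 2 + ∑ i, ∑ j, (eigs z i j) ^ 2 = _
    rw [sum_sq_orthogonal_mul hQ]

theorem frame_rotateFrame {m n : ℕ} {Q : Matrix (Fin m) (Fin m) ℝ}
    (hQ : Q ∈ Matrix.orthogonalGroup (Fin m) ℝ) (z : FrameSpace m n) :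
    frame (rotateFrame Q hQ z) = Q * frame z := rfl

/-- Simultaneous conjugation by an orthogonal matrix, as a linear isometry. -/
def conjTuple {m n : ℕ} (Q : Matrix (Fin m) (Fin m) ℝ)
    (hQ : Q ∈ Matrix.orthogonalGroup (Fin m) ℝ) : TupleSpace m n →ₗᵢ[ℝ] TupleSpace m n where
  toFun M := ofMats fun i => Q * mat M i * Q.transpose
  map_add' M N := by
    ext ⟨i, j, k⟩
    change (Q * (mat M i + mat N i) * Q.transpose) j k =
      (Q * mat M i * Q.transpose + Q * mat N i * Q.transpose) j k
    rw [Matrix.mul_add, Matrix.add_mul]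
  map_smul' c M := by
    ext ⟨i, j, k⟩
    change (Q * (c • mat M i) * Q.transpose) j k = (c • (Q * mat M i * Q.transpose)) j k
    rw [Matrix.mul_smul, Matrix.smul_mul]
  norm_map' M := by
    rw [← sq_eq_sq₀ (norm_nonneg _) (norm_nonneg _), norm_sq_tupleSpace, norm_sq_tupleSpace]
    refine Finset.sum_congr rfl fun i _ => ?_
    change ∑ j, ∑ k, ((Q * mat M i * Q.transpose) j k) ^ 2 = _
    rw [Matrix.mul_assoc, sum_sq_orthogonal_mul hQ]
    have h : ∀ j k, (mat M i * Q.transpose) j k = (Q * (mat M i).transpose) k j := fun j k => by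
      rw [← Matrix.transpose_apply (Q * (mat M i).transpose), Matrix.transpose_mul,
        Matrix.transpose_transpose]
    simp only [h]
    rw [Finset.sum_comm, sum_sq_orthogonal_mul hQ, Finset.sum_comm]
    rfl

theorem spectralMap_rotateFrame {m n : ℕ} {Q : Matrix (Fin m) (Fin m) ℝ}
    (hQ : Q ∈ Matrix.orthogonalGroup (Fin m) ℝ) (z : FrameSpace m n) :
    spectralMap (rotateFrame Q hQ z) = conjTuple Q hQ (spectralMap z) := by
  change ofMats (fun i => (Q * frame z) * Matrix.diagonal (eigs z i) * (Q * frame z).transpose) =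
    ofMats fun i => Q * (frame z * Matrix.diagonal (eigs z i) * (frame z).transpose) * Q.transpose
  simp only [Matrix.transpose_mul, Matrix.mul_assoc]

/-- A product over off-diagonal pairs collects each pair `j < k` with its mirror image. -/
@[to_additive]
theorem prod_offDiag_eq {m : ℕ} {α : Type*} [CommMonoid α] (g : Fin m → Fin m → α) :
    ∏ p : Fin m × Fin m with p.1 ≠ p.2, g p.1 p.2 =
      ∏ p : Fin m × Fin m with p.1 < p.2, (g p.1 p.2 * g p.2 p.1) := by
  rw [Finset.prod_mul_distrib]
  have h : (Finset.univ.filter fun p : Fin m × Fin m => p.1 ≠ p.2) =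
      (Finset.univ.filter fun p : Fin m × Fin m => p.1 < p.2) ∪
      (Finset.univ.filter fun p : Fin m × Fin m => p.2 < p.1) := by
    ext p
    simp only [Finset.mem_filter, Finset.mem_univ, true_and, Finset.mem_union]
    exact ne_iff_lt_or_gt
  rw [h, Finset.prod_union]
  · congr 1
    exact Finset.prod_nbij' Prod.swap Prod.swap (by simp) (by simp) (by simp) (by simp) (by simp)
  · rw [Finset.disjoint_filter]
    intro p _ h1 h2
    exact lt_asymm h1 h2

theorem jointVandermonde_nonneg {m n : ℕ} (l : Fin n → Fin m → ℝ) : 0 ≤ jointVandermonde l :=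
  Finset.prod_nonneg fun _ _ => norm_nonneg _

/-- The square of `jointVandermonde` is a product over all ordered pairs, which does not depend on
the order of the indices. -/
theorem jointVandermonde_sq {m n : ℕ} (l : Fin n → Fin m → ℝ) :
    jointVandermonde l ^ 2 = ∏ p : Fin m × Fin m with p.1 ≠ p.2,
      ‖(WithLp.toLp 2 fun i => l i p.2 - l i p.1 : EuclideanSpace ℝ (Fin n))‖ := by
  rw [prod_offDiag_eq fun j k =>
    ‖(WithLp.toLp 2 fun i => l i k - l i j : EuclideanSpace ℝ (Fin n))‖]
  rw [jointVandermonde, ← Finset.prod_pow]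
  refine Finset.prod_congr rfl fun p _ => ?_
  rw [sq]
  congr 1
  rw [← norm_neg]
  congr 1
  ext i
  simp

theorem jointVandermonde_perm {m n : ℕ} (l : Fin n → Fin m → ℝ) (σ : Equiv.Perm (Fin m)) :
    jointVandermonde (fun i k => l i (σ k)) = jointVandermonde l := by
  rw [← sq_eq_sq₀ (jointVandermonde_nonneg _) (jointVandermonde_nonneg _), jointVandermonde_sq,
    jointVandermonde_sq]
  refine Finset.prod_nbij' (fun p => (σ p.1, σ p.2)) (fun p => (σ.symm p.1, σ.symm p.2))
    ?_ ?_ ?_ ?_ ?_ <;> simp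

theorem jointVandermonde_ne_zero_iff {m n : ℕ} {l : Fin n → Fin m → ℝ} :
    jointVandermonde l ≠ 0 ↔ ∀ j k, j ≠ k → ∃ i, l i j ≠ l i k := by
  have h : ∀ j k, ‖(WithLp.toLp 2 fun i => l i k - l i j : EuclideanSpace ℝ (Fin n))‖ ≠ 0 ↔
      ∃ i, l i j ≠ l i k := by
    intro j k
    rw [norm_ne_zero_iff, ne_eq, ← not_forall_not, not_iff_not]
    simp only [not_not]
    constructor
    · intro h i
      have := congrFun (congrArg WithLp.ofLp h) i
      simp only [PiLp.zero_apply] at this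
      linarith
    · intro h
      ext i
      simp [h i]
  rw [jointVandermonde, Finset.prod_ne_zero_iff]
  simp only [Finset.mem_filter, Finset.mem_univ, true_and, h, Prod.forall]
  constructor
  · intro hl j k hjk
    rcases lt_or_gt_of_ne hjk with hlt | hlt
    · exact hl j k hlt
    · obtain ⟨i, hi⟩ := hl k j hlt
      exact ⟨i, hi.symm⟩
  · exact fun hl j k hjk => hl j k hjk.ne

theorem continuous_jointVandermonde (m n : ℕ) :
    Continuous (jointVandermonde : (Fin n → Fin m → ℝ) → ℝ) := by
  unfold jointVandermonde
  fun_prop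

/-! ### The fibres of the spectral map -/

/-- The signed permutation of the eigenvectors (and the corresponding permutation of the joint
eigenvalues), as a linear isometry. -/
def signedPerm {m n : ℕ} (s : Equiv.Perm (Fin m) × (Fin m → ℤˣ)) :
    FrameSpace m n →ₗᵢ[ℝ] FrameSpace m n where
  toFun z := mkFrame (Matrix.of fun j k => ((s.2 k : ℤ) : ℝ) * frame z j (s.1 k))
    fun i k => eigs z i (s.1 k)
  map_add' z w := frameSpace_ext
    (by
      ext j k
      change _ * (frame z j (s.1 k) + frame w j (s.1 k)) = _ * frame z j (s.1 k) +
        _ * frame w j (s.1 k)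
      ring) rfl
  map_smul' c z := frameSpace_ext
    (by
      ext j k
      change _ * (c * frame z j (s.1 k)) = c * (_ * frame z j (s.1 k))
      ring) rfl
  norm_map' z := by
    have hs : ∀ k, ((s.2 k : ℤ) : ℝ) ^ 2 = 1 := fun k => by
      rcases Int.units_eq_one_or (s.2 k) with h | h <;> simp [h]
    rw [← sq_eq_sq₀ (norm_nonneg _) (norm_nonneg _), norm_sq_frameSpace, norm_sq_frameSpace]
    simp only [LinearMap.coe_mk, AddHom.coe_mk, frame_mkFrame, eigs_mkFrame, Matrix.of_apply,
      mul_pow, hs, one_mul]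
    congr 1
    · exact Finset.sum_congr rfl fun j _ => Equiv.sum_comp s.1 fun k => frame z j k ^ 2
    · exact Finset.sum_congr rfl fun i _ => Equiv.sum_comp s.1 fun k => eigs z i k ^ 2

theorem frame_signedPerm {m n : ℕ} (s : Equiv.Perm (Fin m) × (Fin m → ℤˣ)) (z : FrameSpace m n)
    (j k : Fin m) : frame (signedPerm s z) j k = ((s.2 k : ℤ) : ℝ) * frame z j (s.1 k) := rfl

theorem eigs_signedPerm {m n : ℕ} (s : Equiv.Perm (Fin m) × (Fin m → ℤˣ)) (z : FrameSpace m n) :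
    eigs (signedPerm s z) = fun i k => eigs z i (s.1 k) := rfl

theorem units_int_sq (u : ℤˣ) : ((u : ℤ) : ℝ) * ((u : ℤ) : ℝ) = 1 := by
  rcases Int.units_eq_one_or u with h | h <;> simp [h]

theorem spectralMap_signedPerm {m n : ℕ} (s : Equiv.Perm (Fin m) × (Fin m → ℤˣ))
    (z : FrameSpace m n) : spectralMap (signedPerm s z) = spectralMap z := by
  ext ⟨i, j, k⟩
  rw [spectralMap_apply, spectralMap_apply,
    ← Equiv.sum_comp s.1 fun a => frame z j a * eigs z i a * frame z k a]
  refine Finset.sum_congr rfl fun a _ => ?_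
  rw [frame_signedPerm, frame_signedPerm, eigs_signedPerm]
  linear_combination (frame z j (s.1 a) * eigs z i (s.1 a) * frame z k (s.1 a)) *
    units_int_sq (s.2 a)

theorem signedPerm_mem_orthFrames_iff {m n : ℕ} (s : Equiv.Perm (Fin m) × (Fin m → ℤˣ))
    (z : FrameSpace m n) : signedPerm s z ∈ orthFrames m n ↔ z ∈ orthFrames m n := by
  have h : frame (signedPerm s z) * (frame (signedPerm s z)).transpose =
      frame z * (frame z).transpose := by
    ext j k
    rw [Matrix.mul_apply, Matrix.mul_apply,
      ← Equiv.sum_comp s.1 fun a => frame z j a * (frame z).transpose a k]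
    refine Finset.sum_congr rfl fun a _ => ?_
    rw [Matrix.transpose_apply, Matrix.transpose_apply, frame_signedPerm, frame_signedPerm]
    linear_combination (frame z j (s.1 a) * frame z k (s.1 a)) * units_int_sq (s.2 a)
  simp only [orthFrames, mem_ofPred_eq, Matrix.mem_orthogonalGroup_iff, h]

/-- Two orthonormal frames of joint eigenvectors of the same tuple with pairwise distinct joint
eigenvalues differ by a signed permutation. -/
theorem exists_eq_signedPerm {m n : ℕ} {z w : FrameSpace m n} (hz : z ∈ orthFrames m n)
    (hw : w ∈ orthFrames m n) (hV : jointVandermonde (eigs z) ≠ 0)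
    (h : spectralMap z = spectralMap w) : ∃ s, w = signedPerm s z := by
  set Q := frame z with hQdef
  set P := frame w with hPdef
  -- the transition matrix intertwines the diagonal matrices, so that each of its columns has only
  -- one nonzero entry, at the place where the joint eigenvalues agree
  set R := Q.transpose * P with hR
  have hQ1 : Q.transpose * Q = 1 := transpose_mul_of_mem hz
  have hQ2 : Q * Q.transpose = 1 := mul_transpose_of_mem hz
  have hP1 : P.transpose * P = 1 := transpose_mul_of_mem hw
  have hRR : R.transpose * R = 1 := by
    rw [hR, Matrix.transpose_mul, Matrix.transpose_transpose, Matrix.mul_assoc,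
      ← Matrix.mul_assoc Q, hQ2, Matrix.one_mul, hP1]
  have hPQ : P = Q * R := by rw [hR, ← Matrix.mul_assoc, hQ2, Matrix.one_mul]
  have hcomm : ∀ i, Matrix.diagonal (eigs z i) * R = R * Matrix.diagonal (eigs w i) := by
    intro i
    have hi : Q * Matrix.diagonal (eigs z i) * Q.transpose =
        P * Matrix.diagonal (eigs w i) * P.transpose := congrArg (fun M => mat M i) h
    calc Matrix.diagonal (eigs z i) * R
        = Q.transpose * Q * Matrix.diagonal (eigs z i) * (Q.transpose * P) := by
          rw [hQ1, Matrix.one_mul]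
      _ = Q.transpose * (Q * Matrix.diagonal (eigs z i) * Q.transpose) * P := by
          simp only [Matrix.mul_assoc]
      _ = Q.transpose * P * Matrix.diagonal (eigs w i) * (P.transpose * P) := by
          rw [hi]; simp only [Matrix.mul_assoc]
      _ = R * Matrix.diagonal (eigs w i) := by rw [hP1, Matrix.mul_one]
  have hent : ∀ i a b, R a b ≠ 0 → eigs z i a = eigs w i b := by
    intro i a b hab
    have := congrFun (congrFun (hcomm i) a) b
    rw [Matrix.diagonal_mul, Matrix.mul_diagonal, mul_comm] at this
    exact mul_left_cancel₀ hab this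
  have hcol : ∀ b b', ∑ a, R a b * R a b' = if b = b' then 1 else 0 := by
    intro b b'
    have := congrFun (congrFun hRR b) b'
    rwa [Matrix.mul_apply, Matrix.one_apply] at this
  have hex : ∀ b, ∃ a, R a b ≠ 0 := by
    intro b
    by_contra! hb
    have := hcol b b
    simp [hb] at this
  choose σ hσ using hex
  have huniq : ∀ a b, R a b ≠ 0 → a = σ b := by
    intro a b hab
    by_contra hne
    obtain ⟨i, hi⟩ := jointVandermonde_ne_zero_iff.1 hV a (σ b) hne
    exact hi ((hent i a b hab).trans (hent i (σ b) b (hσ b)).symm)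
  have hsum : ∀ b b', ∑ a, R a b * R a b' = R (σ b) b * R (σ b) b' := fun b b' =>
    Finset.sum_eq_single (σ b) (fun a _ ha => by
      rw [show R a b = 0 from by_contra fun h => ha (huniq a b h), zero_mul]) (by simp)
  have hinj : Function.Injective σ := by
    intro b b' hbb
    by_contra hne
    have := hcol b b'
    rw [hsum, if_neg hne, hbb] at this
    exact mul_ne_zero (hbb ▸ hσ b) (hσ b') this
  have hsign : ∀ b, ∃ u : ℤˣ, R (σ b) b = ((u : ℤ) : ℝ) := by
    intro b
    have := hcol b b
    rw [hsum, if_pos rfl] at this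
    rcases mul_self_eq_one_iff.1 this with h1 | h1
    · exact ⟨1, by simp [h1]⟩
    · exact ⟨-1, by simp [h1]⟩
  choose ε hε using hsign
  refine ⟨(Equiv.ofBijective σ (Finite.injective_iff_bijective.1 hinj), ε), frameSpace_ext ?_ ?_⟩
  · ext j k
    rw [frame_signedPerm, ← hPdef, hPQ, Matrix.mul_apply, Finset.sum_eq_single (σ k), hε k,
      mul_comm]
    · rfl
    · intro a _ ha
      rw [show R a k = 0 from by_contra fun h => ha (huniq a k h), mul_zero]
    · simp
  · funext i k
    rw [eigs_signedPerm]
    exact (hent i (σ k) k (hσ k)).symm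

theorem signedPerm_injective_of_ne_zero {m n : ℕ} {z : FrameSpace m n} (hz : z ∈ orthFrames m n)
    (hV : jointVandermonde (eigs z) ≠ 0) {s t : Equiv.Perm (Fin m) × (Fin m → ℤˣ)}
    (h : signedPerm s z = signedPerm t z) : s = t := by
  have h1 : s.1 = t.1 := by
    ext k : 1
    by_contra hne
    obtain ⟨i, hi⟩ := jointVandermonde_ne_zero_iff.1 hV _ _ hne
    exact hi (congrFun (congrFun (congrArg eigs h) i) k)
  refine Prod.ext h1 (funext fun k => ?_)
  have h2 : ∀ j, ((s.2 k : ℤ) : ℝ) * frame z j (s.1 k) = ((t.2 k : ℤ) : ℝ) * frame z j (s.1 k) := by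
    intro j
    have := congrFun (congrFun (congrArg frame h) j) k
    rwa [frame_signedPerm, frame_signedPerm, ← h1] at this
  have h3 : ∃ j, frame z j (s.1 k) ≠ 0 := by
    by_contra! h0
    have := congrFun (congrFun (transpose_mul_of_mem hz) (s.1 k)) (s.1 k)
    simp [Matrix.mul_apply, h0] at this
  obtain ⟨j, hj⟩ := h3
  have := mul_right_cancel₀ hj (h2 j)
  exact Units.ext (by exact_mod_cast this)

/-! ### Cayley coordinates -/

/-- The Cayley transform `2 (1 + A)⁻¹ - 1 = (1 - A) (1 + A)⁻¹`. It exchanges skew-symmetric and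
orthogonal matrices, and it is an involution. -/
def cayley {m : ℕ} (A : Matrix (Fin m) (Fin m) ℝ) : Matrix (Fin m) (Fin m) ℝ :=
  (2 : ℝ) • (1 + A)⁻¹ - 1

theorem cayley_zero {m : ℕ} : cayley (0 : Matrix (Fin m) (Fin m) ℝ) = 1 := by
  rw [cayley, add_zero, inv_one, two_smul, add_sub_cancel_right]

theorem isUnit_det_one_add_one {m : ℕ} :
    IsUnit (1 + 1 : Matrix (Fin m) (Fin m) ℝ).det := by
  rw [one_add_one_eq_two, ← Nat.cast_ofNat, ← Matrix.diagonal_natCast, Matrix.det_diagonal]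
  simp

theorem cayley_cayley {m : ℕ} {A : Matrix (Fin m) (Fin m) ℝ} (hA : IsUnit (1 + A).det) :
    cayley (cayley A) = A := by
  have h : (1 + cayley A)⁻¹ = (2 : ℝ)⁻¹ • (1 + A) := by
    refine Matrix.inv_eq_right_inv ?_
    rw [cayley, add_sub_cancel, Matrix.smul_mul, Matrix.mul_smul, Matrix.nonsing_inv_mul _ hA,
      smul_smul]
    norm_num
  rw [cayley, h, smul_smul]
  norm_num

theorem cayley_one {m : ℕ} : cayley (1 : Matrix (Fin m) (Fin m) ℝ) = 0 := by
  rw [← cayley_zero, cayley_cayley]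
  simp

/-- The Cayley transform of an orthogonal matrix is skew-symmetric. -/
theorem transpose_cayley_of_mem {m : ℕ} {Q : Matrix (Fin m) (Fin m) ℝ}
    (hQ : Q ∈ Matrix.orthogonalGroup (Fin m) ℝ) (h : IsUnit (1 + Q).det) :
    (cayley Q).transpose = -cayley Q := by
  have h1 : (1 + Q.transpose)⁻¹ = (1 + Q)⁻¹ * Q := by
    refine Matrix.inv_eq_left_inv ?_
    rw [Matrix.mul_assoc, Matrix.mul_add, Matrix.mul_one, mul_transpose_of_mem hQ, add_comm Q,
      Matrix.nonsing_inv_mul _ h]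
  have h2 : (1 + Q)⁻¹ + (1 + Q)⁻¹ * Q = 1 := by
    have := Matrix.nonsing_inv_mul _ h
    rwa [Matrix.mul_add, Matrix.mul_one] at this
  have h3 : (cayley Q).transpose = (2 : ℝ) • ((1 + Q)⁻¹ * Q) - 1 := by
    rw [cayley, Matrix.transpose_sub, Matrix.transpose_smul, Matrix.transpose_nonsing_inv,
      Matrix.transpose_add, Matrix.transpose_one, h1]
  rw [h3, cayley, eq_sub_of_add_eq' h2, smul_sub, two_smul ℝ (1 : Matrix (Fin m) (Fin m) ℝ)]
  abel

/-- The Cayley transform of a skew-symmetric matrix is orthogonal. -/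
theorem cayley_mem_of_transpose {m : ℕ} {A : Matrix (Fin m) (Fin m) ℝ}
    (hA : A.transpose = -A) (h : IsUnit (1 + A).det) :
    cayley A ∈ Matrix.orthogonalGroup (Fin m) ℝ := by
  have h' : IsUnit (1 - A).det := by
    rw [← Matrix.det_transpose, Matrix.transpose_sub, Matrix.transpose_one, hA, sub_neg_eq_add]
    exact h
  have h1 : (cayley A).transpose = (2 : ℝ) • (1 - A)⁻¹ - 1 := by
    rw [cayley, Matrix.transpose_sub, Matrix.transpose_smul, Matrix.transpose_nonsing_inv,
      Matrix.transpose_add, Matrix.transpose_one, hA, sub_eq_add_neg 1 A]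
  have h2 : (2 : ℝ) • ((1 - A)⁻¹ * (1 + A)⁻¹) = (1 - A)⁻¹ + (1 + A)⁻¹ := by
    calc (2 : ℝ) • ((1 - A)⁻¹ * (1 + A)⁻¹)
        = (1 - A)⁻¹ * ((1 + A) + (1 - A)) * (1 + A)⁻¹ := by
          rw [add_add_sub_cancel, Matrix.mul_add, Matrix.mul_one, Matrix.add_mul, two_smul]
      _ = _ := by
          rw [Matrix.mul_add, Matrix.add_mul, Matrix.mul_assoc, Matrix.mul_nonsing_inv _ h,
            Matrix.nonsing_inv_mul _ h', Matrix.mul_one, Matrix.one_mul]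
  refine mem_of_transpose_mul ?_
  rw [h1, cayley, Matrix.sub_mul, Matrix.mul_sub, Matrix.smul_mul, Matrix.mul_smul, h2,
    Matrix.mul_one, Matrix.one_mul, smul_add]
  abel

theorem continuousAt_cayley_one {m : ℕ} :
    ContinuousAt (cayley : Matrix (Fin m) (Fin m) ℝ → Matrix (Fin m) (Fin m) ℝ) 1 := by
  have h : ContinuousAt (fun A : Matrix (Fin m) (Fin m) ℝ => (1 + A)⁻¹) 1 := by
    simp only [Matrix.inv_def, Ring.inverse_eq_inv']
    have h1 : Continuous fun A : Matrix (Fin m) (Fin m) ℝ => (1 + A).det := by fun_prop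
    have h2 : Continuous fun A : Matrix (Fin m) (Fin m) ℝ => (1 + A).adjugate := by fun_prop
    exact (h1.continuousAt.inv₀ isUnit_det_one_add_one.ne_zero).smul h2.continuousAt
  exact (h.const_smul (2 : ℝ)).sub (continuousAt_const (y := (1 : Matrix (Fin m) (Fin m) ℝ)))

/-- The pairs `(j, k)` with `j < k`. -/
abbrev Pairs (m : ℕ) : Type := {p : Fin m × Fin m // p.1 < p.2}

/-- The space of local coordinates: the entries of a skew-symmetric matrix above the diagonal,
and joint eigenvalues. -/
abbrev ChartSpace (m n : ℕ) : Type := EuclideanSpace ℝ (Pairs m ⊕ (Fin n × Fin m))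

@[to_additive]
theorem prod_pairs {m : ℕ} {α : Type*} [CommMonoid α] (f : Fin m × Fin m → α) :
    ∏ p : Pairs m, f p.1 = ∏ p : Fin m × Fin m with p.1 < p.2, f p :=
  (Finset.prod_subtype _ (by simp) f).symm

theorem sum_sum_eq_diag_add {m : ℕ} (g : Fin m → Fin m → ℝ) :
    ∑ j, ∑ k, g j k = ∑ j, g j j + ∑ p : Pairs m, (g p.1.1 p.1.2 + g p.1.2 p.1.1) := by
  rw [sum_pairs fun p => g p.1 p.2 + g p.2 p.1, ← sum_offDiag_eq, ← Fintype.sum_prod_type',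
    ← Finset.sum_filter_add_sum_filter_not Finset.univ fun p : Fin m × Fin m => p.1 = p.2]
  congr 1
  exact Finset.sum_nbij' Prod.fst (fun j => (j, j)) (by simp) (by simp)
    (by rintro ⟨j, k⟩ h; simpa using h) (by simp) (by rintro ⟨j, k⟩ h; simp at h; simp [h])

theorem card_pairs (m : ℕ) : Fintype.card (Pairs m) = m.choose 2 := by
  have h := sum_sum_eq_diag_add (m := m) fun _ _ => 1
  simp only [Finset.sum_const, Finset.card_univ, Fintype.card_fin, nsmul_eq_mul, mul_one] at h
  have h2 : m * m = m + Fintype.card (Pairs m) * 2 := by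
    have : (m : ℝ) * m = m + Fintype.card (Pairs m) * 2 := by rw [h]; norm_num
    exact_mod_cast this
  rw [Nat.choose_two_right]
  rcases m with _ | m
  · simp
  · rw [Nat.add_sub_cancel]
    have : (m + 1) * m = Fintype.card (Pairs (m + 1)) * 2 := by
      have : (m + 1) * (m + 1) = (m + 1) * m + (m + 1) := by ring
      omega
    rw [this]
    simp

theorem finrank_chartSpace (m n : ℕ) : Module.finrank ℝ (ChartSpace m n) = simDiagDim m n := by
  rw [finrank_euclideanSpace, Fintype.card_sum, card_pairs, Fintype.card_prod, Fintype.card_fin,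
    Fintype.card_fin, simDiagDim, add_comm]

/-- The skew-symmetric matrix with given entries above the diagonal. -/
def skewMat {m n : ℕ} : ChartSpace m n →ₗ[ℝ] Matrix (Fin m) (Fin m) ℝ where
  toFun v := Matrix.of fun j k =>
    if h : j < k then v (Sum.inl ⟨(j, k), h⟩) else
      if h : k < j then -v (Sum.inl ⟨(k, j), h⟩) else 0
  map_add' v w := by
    ext j k
    simp only [Matrix.of_apply, Matrix.add_apply, PiLp.add_apply]
    split_ifs <;> ring
  map_smul' c v := by
    ext j k
    simp only [Matrix.of_apply, Matrix.smul_apply, PiLp.smul_apply, RingHom.id_apply, smul_eq_mul]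
    split_ifs <;> ring

theorem skewMat_apply_pair {m n : ℕ} (v : ChartSpace m n) (p : Pairs m) :
    skewMat v p.1.1 p.1.2 = v (Sum.inl p) := by
  simp [skewMat, p.2]

theorem skewMat_apply_pair' {m n : ℕ} (v : ChartSpace m n) (p : Pairs m) :
    skewMat v p.1.2 p.1.1 = -v (Sum.inl p) := by
  simp [skewMat, p.2, p.2.le]

theorem skewMat_apply_diag {m n : ℕ} (v : ChartSpace m n) (j : Fin m) : skewMat v j j = 0 := by
  simp [skewMat]

theorem transpose_skewMat {m n : ℕ} (v : ChartSpace m n) :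
    (skewMat v).transpose = -skewMat v := by
  ext j k
  simp only [skewMat, LinearMap.coe_mk, AddHom.coe_mk, Matrix.transpose_apply, Matrix.of_apply,
    Matrix.neg_apply]
  rcases lt_trichotomy j k with h | h | h
  · simp [h, h.not_gt]
  · simp [h]
  · simp [h, h.not_gt]

theorem skewMat_eq_of_transpose {m n : ℕ} {A : Matrix (Fin m) (Fin m) ℝ} (hA : A.transpose = -A)
    {v : ChartSpace m n} (h : ∀ p : Pairs m, v (Sum.inl p) = A p.1.1 p.1.2) : skewMat v = A := by
  have hA' : ∀ j k, A k j = -A j k := fun j k => congrFun (congrFun hA j) k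
  ext j k
  rcases lt_trichotomy j k with hjk | hjk | hjk
  · rw [← h ⟨(j, k), hjk⟩]; exact skewMat_apply_pair v ⟨(j, k), hjk⟩
  · subst hjk
    rw [skewMat_apply_diag]
    linarith [hA' j j]
  · rw [hA', ← h ⟨(k, j), hjk⟩]; exact skewMat_apply_pair' v ⟨(k, j), hjk⟩

/-- The joint eigenvalue coordinates. -/
def chartEigs {m n : ℕ} (v : ChartSpace m n) : Fin n → Fin m → ℝ := fun i j => v (Sum.inr (i, j))

/-- Near frames with `Q = 1`, the pairs `(Q, l)` with orthogonal `Q` are parametrized by the Cayley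
transform. -/
def chart {m n : ℕ} (v : ChartSpace m n) : FrameSpace m n :=
  mkFrame (cayley (skewMat v)) (chartEigs v)

/-- The local inverse of `chart`. -/
def chartInv {m n : ℕ} (z : FrameSpace m n) : ChartSpace m n :=
  WithLp.toLp 2 (Sum.elim (fun p => cayley (frame z) p.1.1 p.1.2) fun p => eigs z p.1 p.2)

/-- The coordinates of the point `(1, l)`. -/
def chartPt {m n : ℕ} (l : Fin n → Fin m → ℝ) : ChartSpace m n :=
  WithLp.toLp 2 (Sum.elim 0 fun p => l p.1 p.2)

theorem skewMat_chartPt {m n : ℕ} (l : Fin n → Fin m → ℝ) : skewMat (chartPt l) = 0 := by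
  ext j k
  simp [skewMat, chartPt]

theorem chart_chartPt {m n : ℕ} (l : Fin n → Fin m → ℝ) : chart (chartPt l) = mkFrame 1 l := by
  rw [chart, skewMat_chartPt, cayley_zero]
  rfl

theorem chartInv_mkFrame_one {m n : ℕ} (l : Fin n → Fin m → ℝ) :
    chartInv (mkFrame 1 l) = chartPt l := by
  rw [chartInv, frame_mkFrame, cayley_one]
  rfl

/-- The chart recovers orthogonal frames, as the Cayley transform is an involution. -/
theorem chart_chartInv {m n : ℕ} {z : FrameSpace m n} (hz : z ∈ orthFrames m n)
    (h : IsUnit (1 + frame z).det) : chart (chartInv z) = z := by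
  refine frameSpace_ext ?_ rfl
  change cayley (skewMat (chartInv z)) = _
  rw [skewMat_eq_of_transpose (transpose_cayley_of_mem hz h) fun p => rfl, cayley_cayley h]

theorem continuousAt_chartInv {m n : ℕ} (l : Fin n → Fin m → ℝ) :
    ContinuousAt (chartInv : FrameSpace m n → ChartSpace m n) (mkFrame 1 l) := by
  refine (PiLp.continuous_toLp 2 _).continuousAt.comp (continuousAt_pi.2 ?_)
  have h : ContinuousAt (fun z : FrameSpace m n => cayley (frame z)) (mkFrame 1 l) :=
    ContinuousAt.comp (g := cayley) (f := frame) (x := (mkFrame 1 l : FrameSpace m n))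
      (by rw [frame_mkFrame]; exact continuousAt_cayley_one) (continuous_frame m n).continuousAt
  rintro (p | p)
  · exact ((continuous_id.matrix_elem p.1.1 p.1.2).continuousAt).comp h
  · exact ((continuous_apply_apply p.1 p.2).comp (continuous_eigs m n)).continuousAt

theorem eventually_isUnit_det_one_add {m n : ℕ} (l : Fin n → Fin m → ℝ) :
    ∀ᶠ z : FrameSpace m n in 𝓝 (mkFrame 1 l), IsUnit (1 + frame z).det := by
  have hc : Continuous fun z : FrameSpace m n => (1 + frame z).det := by
    have := continuous_frame m n
    fun_prop
  filter_upwards [hc.continuousAt.eventually_ne (isUnit_det_one_add_one (m := m)).ne_zero] with z hz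
  exact isUnit_iff_ne_zero.2 hz

/-- The chart covers a neighbourhood of `(1, l)` among the pairs with orthogonal frame. -/
theorem exists_nhds_subset_image_chart {m n : ℕ} (l : Fin n → Fin m → ℝ) {U : Set (ChartSpace m n)}
    (hU : U ∈ 𝓝 (chartPt l)) :
    ∃ W ∈ 𝓝 (mkFrame 1 l), W ∩ orthFrames m n ⊆ chart '' U := by
  have h1 := continuousAt_chartInv (m := m) (n := n) l
  rw [ContinuousAt, chartInv_mkFrame_one] at h1
  refine ⟨_, Filter.inter_mem (h1 hU) (eventually_isUnit_det_one_add l), fun z hz => ?_⟩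
  exact ⟨chartInv z, hz.1.1, chart_chartInv hz.2 hz.1.2⟩

theorem eventually_chart_mem_orthFrames {m n : ℕ} (l : Fin n → Fin m → ℝ) :
    ∀ᶠ v : ChartSpace m n in 𝓝 (chartPt l), chart v ∈ orthFrames m n := by
  have hs : Continuous (skewMat : ChartSpace m n → Matrix (Fin m) (Fin m) ℝ) :=
    LinearMap.continuous_of_finiteDimensional _
  have hc : Continuous fun v : ChartSpace m n => (1 + skewMat v).det := by fun_prop
  have h0 : (1 + skewMat (chartPt l : ChartSpace m n)).det ≠ 0 := by
    rw [skewMat_chartPt, add_zero, Matrix.det_one]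
    exact one_ne_zero
  filter_upwards [hc.continuousAt.eventually_ne h0] with v hv
  exact cayley_mem_of_transpose (transpose_skewMat v) (isUnit_iff_ne_zero.2 hv)

/-! ### Jacobians in Cayley coordinates -/

section Derivatives

-- inversion is differentiated in a normed algebra; any complete norm on matrices would do
attribute [local instance] Matrix.linftyOpNormedRing Matrix.linftyOpNormedAlgebra

theorem hasStrictFDerivAt_cayley_skewMat {m n : ℕ} {v₀ : ChartSpace m n} (h₀ : skewMat v₀ = 0)
    (j k : Fin m) :
    HasStrictFDerivAt (fun v : ChartSpace m n => cayley (skewMat v) j k)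
      (LinearMap.toContinuousLinearMap
        ((Matrix.entryLinearMap ℝ ℝ j k) ∘ₗ ((-2 : ℝ) • skewMat (m := m) (n := n)))) v₀ := by
  have h1 : HasStrictFDerivAt (fun v : ChartSpace m n => 1 + skewMat v)
      (LinearMap.toContinuousLinearMap (skewMat (m := m) (n := n))) v₀ :=
    (LinearMap.toContinuousLinearMap (skewMat (m := m) (n := n))).hasStrictFDerivAt.const_add 1
  have h2 := hasStrictFDerivAt_ringInverse (𝕜 := ℝ) (1 : (Matrix (Fin m) (Fin m) ℝ)ˣ)
  have h3 : HasStrictFDerivAt (fun v : ChartSpace m n => Ring.inverse (1 + skewMat v)) _ v₀ :=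
    HasStrictFDerivAt.comp (g := Ring.inverse) v₀ (by simpa [h₀] using h2) h1
  have h4 := (LinearMap.toContinuousLinearMap
    (Matrix.entryLinearMap ℝ ℝ j k)).hasStrictFDerivAt.comp v₀ ((h3.const_smul (2 : ℝ)).sub_const 1)
  refine (h4.congr_fderiv ?_).congr_of_eventuallyEq (Eventually.of_forall fun v => ?_)
  · ext v
    change ((2 : ℝ) • -((1 : Matrix (Fin m) (Fin m) ℝ) * skewMat v * 1) :
      Matrix (Fin m) (Fin m) ℝ) j k =
      ((-2 : ℝ) • skewMat v) j k
    simp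
  · simp [cayley, Matrix.nonsing_inv_eq_ringInverse]

end Derivatives

/-- The derivative of `chart` at `(1, l)`. -/
def chartDeriv (m n : ℕ) : ChartSpace m n →ₗ[ℝ] FrameSpace m n where
  toFun v := mkFrame ((-2 : ℝ) • skewMat v) (chartEigs v)
  map_add' v w := frameSpace_ext
    (by
      change (-2 : ℝ) • skewMat (v + w) = (-2 : ℝ) • skewMat v + (-2 : ℝ) • skewMat w
      rw [map_add, smul_add]) rfl
  map_smul' c v := frameSpace_ext
    (by
      change (-2 : ℝ) • skewMat (c • v) = c • ((-2 : ℝ) • skewMat v)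
      rw [map_smul, smul_comm]) rfl

theorem hasStrictFDerivAt_chart {m n : ℕ} (l : Fin n → Fin m → ℝ) :
    HasStrictFDerivAt (chart : ChartSpace m n → FrameSpace m n)
      (LinearMap.toContinuousLinearMap (chartDeriv m n)) (chartPt l) := by
  rw [hasStrictFDerivAt_euclidean]
  rintro (p | p)
  · exact (hasStrictFDerivAt_cayley_skewMat (skewMat_chartPt l) p.1 p.2).congr_fderiv
      (by ext v; rfl)
  · exact (PiLp.proj (𝕜 := ℝ) 2 (fun _ : Pairs m ⊕ (Fin n × Fin m) => ℝ)
      (Sum.inr p)).hasStrictFDerivAt.congr_fderiv (by ext v; rfl)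

/-- The derivative of `spectralMap` at `(1, l)`. -/
def spectralDeriv {m n : ℕ} (l : Fin n → Fin m → ℝ) : FrameSpace m n →ₗ[ℝ] TupleSpace m n where
  toFun w := WithLp.toLp 2 fun p =>
    l p.1 p.2.2 * frame w p.2.1 p.2.2 + l p.1 p.2.1 * frame w p.2.2 p.2.1 +
      if p.2.1 = p.2.2 then eigs w p.1 p.2.1 else 0
  map_add' v w := by
    ext p
    simp only [frame, eigs, Matrix.of_apply, PiLp.add_apply]
    split_ifs <;> ring
  map_smul' c v := by
    ext p
    simp only [frame, eigs, Matrix.of_apply, PiLp.smul_apply, smul_eq_mul, RingHom.id_apply]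
    split_ifs <;> ring

theorem hasStrictFDerivAt_spectralMap {m n : ℕ} (l : Fin n → Fin m → ℝ) :
    HasStrictFDerivAt (spectralMap : FrameSpace m n → TupleSpace m n)
      (LinearMap.toContinuousLinearMap (spectralDeriv l)) (mkFrame 1 l) := by
  rw [hasStrictFDerivAt_euclidean]
  rintro ⟨i, j, k⟩
  have hc : ∀ p, HasStrictFDerivAt (fun z : FrameSpace m n => z p)
      (PiLp.proj (𝕜 := ℝ) 2 (fun _ : (Fin m × Fin m) ⊕ (Fin n × Fin m) => ℝ) p) (mkFrame 1 l) :=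
    fun p => (PiLp.proj (𝕜 := ℝ) 2 (fun _ => ℝ) p).hasStrictFDerivAt
  have h := HasStrictFDerivAt.fun_sum (u := Finset.univ) fun (a : Fin m) _ =>
    ((hc (Sum.inl (j, a))).mul (hc (Sum.inr (i, a)))).mul (hc (Sum.inl (k, a)))
  refine (h.congr_fderiv ?_).congr_of_eventuallyEq (Eventually.of_forall fun z => ?_)
  · ext w
    simp [mkFrame, spectralDeriv, frame, eigs, Matrix.one_apply, Finset.sum_add_distrib]
    rcases eq_or_ne j k with rfl | hjk
    · simp
      ring
    · simp [hjk, hjk.symm]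
      ring
  · exact (spectralMap_apply z i j k).symm

/-- The linear map of `ChartSpace` which multiplies the coordinates of index `p : Pairs m` by
`c p`. -/
def scalePairs {m : ℕ} (n : ℕ) (c : Pairs m → ℝ) : ChartSpace m n →ₗ[ℝ] ChartSpace m n :=
  Matrix.toLpLin 2 2 (Matrix.diagonal (Sum.elim c 1))

theorem det_scalePairs {m n : ℕ} (c : Pairs m → ℝ) :
    LinearMap.det (scalePairs n c) = ∏ p, c p := by
  rw [scalePairs, LinearMap.det_toLpLin, Matrix.det_diagonal, Fintype.prod_sum_type]
  simp

theorem norm_sq_scalePairs {m n : ℕ} (c : Pairs m → ℝ) (v : ChartSpace m n) :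
    ‖scalePairs n c v‖ ^ 2 =
      ∑ p, c p ^ 2 * v (Sum.inl p) ^ 2 + ∑ i, ∑ j, chartEigs v i j ^ 2 := by
  rw [EuclideanSpace.norm_sq_eq, Fintype.sum_sum_type, Fintype.sum_prod_type]
  simp [scalePairs, Matrix.toLpLin_apply, Matrix.mulVec_diagonal, mul_pow, chartEigs]

/-- The derivative of `chart` scales lengths like a diagonal map, which gives its Jacobian. -/
theorem norm_chartDeriv {m n : ℕ} (v : ChartSpace m n) :
    ‖chartDeriv m n v‖ = ‖scalePairs n (fun _ => √8) v‖ := by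
  rw [← sq_eq_sq₀ (norm_nonneg _) (norm_nonneg _), norm_sq_frameSpace, norm_sq_scalePairs]
  change ∑ j, ∑ k, ((-2 : ℝ) * skewMat v j k) ^ 2 + ∑ i, ∑ j, chartEigs v i j ^ 2 = _
  rw [sum_sum_eq_diag_add]
  simp only [skewMat_apply_diag, skewMat_apply_pair, skewMat_apply_pair']
  norm_num
  exact Finset.sum_congr rfl fun p _ => by ring

/-- The computation behind the Weyl formula: an infinitesimal rotation in the plane `(j, k)` moves
the tuple of `diagonal (l i)` with a speed proportional to the distance of its `j`-th and `k`-th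
joint eigenvalues, and different planes move it in orthogonal directions. -/
theorem norm_spectralDeriv_chartDeriv {m n : ℕ} (l : Fin n → Fin m → ℝ) (v : ChartSpace m n) :
    ‖spectralDeriv l (chartDeriv m n v)‖ = ‖scalePairs n (fun p => √8 *
      ‖(WithLp.toLp 2 fun i => l i p.1.2 - l i p.1.1 : EuclideanSpace ℝ (Fin n))‖) v‖ := by
  rw [← sq_eq_sq₀ (norm_nonneg _) (norm_nonneg _), norm_sq_tupleSpace, norm_sq_scalePairs]
  have h : ∀ i j k, mat (spectralDeriv l (chartDeriv m n v)) i j k =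
      l i k * (-2 * skewMat v j k) + l i j * (-2 * skewMat v k j) +
        if j = k then chartEigs v i j else 0 := fun i j k => rfl
  simp only [h, sum_sum_eq_diag_add, skewMat_apply_diag, skewMat_apply_pair, skewMat_apply_pair']
  rw [Finset.sum_add_distrib, add_comm]
  congr 1
  · rw [Finset.sum_comm]
    refine Finset.sum_congr rfl fun p _ => ?_
    rw [mul_pow, EuclideanSpace.norm_sq_eq, Finset.mul_sum, Finset.sum_mul]
    refine Finset.sum_congr rfl fun i _ => ?_
    rw [if_neg p.2.ne, if_neg p.2.ne', Real.sq_sqrt (by norm_num), Real.norm_eq_abs, sq_abs]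
    ring
  · simp

/-- The Jacobian of `chart` at the points `(1, l)`: each coordinate above the diagonal contributes
the factor `√8 = √(2² + 2²)`, as it gives two entries of the derivative `-2 * skewMat v`. -/
def chartJacobian (m : ℕ) : ℝ := √8 ^ Fintype.card (Pairs m)

theorem chartJacobian_pos (m : ℕ) : 0 < chartJacobian m := by
  unfold chartJacobian
  positivity

/-- The area formula for `chart`. -/
theorem exists_nhds_area_chart {m n : ℕ} (l : Fin n → Fin m → ℝ) {K : ℝ≥0} (hK : 1 < K) :
    ∃ U ∈ 𝓝 (chartPt l : ChartSpace m n), ∀ B ⊆ U,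
      μHE[simDiagDim m n] (chart '' B) ≤
        (K : ℝ≥0∞) ^ simDiagDim m n * (ENNReal.ofReal (chartJacobian m) * volume B) ∧
      ENNReal.ofReal (chartJacobian m) * volume B ≤
        (K : ℝ≥0∞) ^ simDiagDim m n * μHE[simDiagDim m n] (chart '' B) := by
  have hdet : LinearMap.det (scalePairs (m := m) n fun _ => √8) = chartJacobian m := by
    rw [det_scalePairs, Finset.prod_const, chartJacobian, Finset.card_univ]
  obtain ⟨U, hU, -, h⟩ := exists_nhds_euclideanHausdorffMeasure_image (hasStrictFDerivAt_chart l)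
    (scalePairs n fun _ => √8) norm_chartDeriv (by rw [hdet]; exact (chartJacobian_pos m).ne')
    (finrank_chartSpace m n) hK
  rw [hdet, abs_of_pos (chartJacobian_pos m)] at h
  exact ⟨U, hU, h⟩

/-- The area formula for `spectralMap ∘ chart`. -/
theorem exists_nhds_area_spectralMap_chart {m n : ℕ} {l : Fin n → Fin m → ℝ}
    (hl : jointVandermonde l ≠ 0) {K : ℝ≥0} (hK : 1 < K) :
    ∃ U ∈ 𝓝 (chartPt l : ChartSpace m n), InjOn (fun v => spectralMap (chart v)) U ∧ ∀ B ⊆ U,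
      μHE[simDiagDim m n] ((fun v => spectralMap (chart v)) '' B) ≤ (K : ℝ≥0∞) ^ simDiagDim m n *
        (ENNReal.ofReal (chartJacobian m * jointVandermonde l) * volume B) ∧
      ENNReal.ofReal (chartJacobian m * jointVandermonde l) * volume B ≤
        (K : ℝ≥0∞) ^ simDiagDim m n *
          μHE[simDiagDim m n] ((fun v => spectralMap (chart v)) '' B) := by
  set c : Pairs m → ℝ := fun p => √8 *
      ‖(WithLp.toLp 2 fun i => l i p.1.2 - l i p.1.1 : EuclideanSpace ℝ (Fin n))‖ with hc
  have hdet : LinearMap.det (scalePairs (m := m) n c) = chartJacobian m * jointVandermonde l := by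
    rw [det_scalePairs, Finset.prod_mul_distrib, Finset.prod_const, chartJacobian,
      Finset.card_univ, jointVandermonde, ← prod_pairs fun p : Fin m × Fin m =>
        ‖(WithLp.toLp 2 fun i => l i p.2 - l i p.1 : EuclideanSpace ℝ (Fin n))‖]
  have hpos : 0 < chartJacobian m * jointVandermonde l :=
    mul_pos (chartJacobian_pos m) ((jointVandermonde_nonneg l).lt_of_ne' hl)
  have hs := hasStrictFDerivAt_spectralMap l
  rw [← chart_chartPt] at hs
  obtain ⟨U, hU, hinj, h⟩ := exists_nhds_euclideanHausdorffMeasure_image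
    (hs.comp _ (hasStrictFDerivAt_chart l))
    (scalePairs n c) (norm_spectralDeriv_chartDeriv l) (by rw [hdet]; exact hpos.ne')
    (finrank_chartSpace m n) hK
  rw [hdet, abs_of_pos hpos] at h
  exact ⟨U, hU, hinj, h⟩

/-! ### The volume of the space of frames and eigenvalues -/

theorem transpose_rotateFrame_eq {m n : ℕ} {z : FrameSpace m n} (hz : z ∈ orthFrames m n) :
    rotateFrame (frame z).transpose (transpose_mem hz) z = mkFrame 1 (eigs z) :=
  frameSpace_ext (transpose_mul_of_mem hz) rfl

theorem rotateFrame_mem_orthFrames {m n : ℕ} {Q : Matrix (Fin m) (Fin m) ℝ}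
    (hQ : Q ∈ Matrix.orthogonalGroup (Fin m) ℝ) {z : FrameSpace m n} (hz : z ∈ orthFrames m n) :
    rotateFrame Q hQ z ∈ orthFrames m n :=
  mul_mem hQ hz

/-- The pairs `(Q, l)` with `Q` orthogonal have locally finite volume, by the area formula for
`chart`. -/
theorem exists_nhds_volume_orthFrames_lt_top {m n : ℕ} {z : FrameSpace m n}
    (hz : z ∈ orthFrames m n) :
    ∃ W ∈ 𝓝 z, μHE[simDiagDim m n] (W ∩ orthFrames m n) < ⊤ := by
  obtain ⟨U, hU, h⟩ := exists_nhds_area_chart (m := m) (eigs z) (K := 2) (by norm_num)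
  obtain ⟨W, hW, hWU⟩ := exists_nhds_subset_image_chart (eigs z)
    (Filter.inter_mem hU (Metric.closedBall_mem_nhds (chartPt (eigs z)) one_pos))
  rw [← transpose_rotateFrame_eq hz] at hW
  set R := rotateFrame (n := n) (frame z).transpose (transpose_mem hz) with hR
  refine ⟨R ⁻¹' W, R.continuous.continuousAt hW, ?_⟩
  rw [← R.isometry.euclideanHausdorffMeasure_image]
  have hsub : R '' (R ⁻¹' W ∩ orthFrames m n) ⊆
      chart '' (U ∩ Metric.closedBall (chartPt (eigs z)) 1) := by
    rintro _ ⟨y, ⟨hyW, hy⟩, rfl⟩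
    exact hWU ⟨hyW, rotateFrame_mem_orthFrames _ hy⟩
  refine (measure_mono hsub).trans_lt ((h _ inter_subset_left).1.trans_lt ?_)
  have hfin : volume (U ∩ Metric.closedBall (chartPt (eigs z) : ChartSpace m n) 1) < ⊤ :=
    (measure_mono inter_subset_right).trans_lt measure_closedBall_lt_top
  exact ENNReal.mul_lt_top (ENNReal.pow_lt_top ENNReal.coe_lt_top)
    (ENNReal.mul_lt_top ENNReal.ofReal_lt_top hfin)

/-- The Riemannian volume of the space of pairs `(Q, l)` with `Q` orthogonal. -/
def frameVolume (m n : ℕ) : Measure (FrameSpace m n) :=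
  (μHE[simDiagDim m n]).restrict (orthFrames m n)

theorem frameVolume_apply_of_subset {m n : ℕ} {B : Set (FrameSpace m n)} (hB : B ⊆ orthFrames m n) :
    frameVolume m n B = μHE[simDiagDim m n] B := by
  rw [frameVolume, Measure.restrict_apply' (isClosed_orthFrames m n).measurableSet,
    inter_eq_left.2 hB]

theorem frameVolume_inter_orthFrames {m n : ℕ} (B : Set (FrameSpace m n)) :
    frameVolume m n (B ∩ orthFrames m n) = frameVolume m n B := by
  rw [frameVolume, Measure.restrict_apply' (isClosed_orthFrames m n).measurableSet,
    Measure.restrict_apply' (isClosed_orthFrames m n).measurableSet, inter_assoc, inter_self]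

instance (m n : ℕ) : IsLocallyFiniteMeasure (frameVolume m n) := by
  refine ⟨fun z => ?_⟩
  by_cases hz : z ∈ orthFrames m n
  · obtain ⟨W, hW, h⟩ := exists_nhds_volume_orthFrames_lt_top hz
    refine ⟨W, hW, ?_⟩
    rwa [frameVolume, Measure.restrict_apply' (isClosed_orthFrames m n).measurableSet]
  · refine ⟨(orthFrames m n)ᶜ, (isClosed_orthFrames m n).isOpen_compl.mem_nhds hz, ?_⟩
    rw [frameVolume, Measure.restrict_apply' (isClosed_orthFrames m n).measurableSet,
      compl_inter_self, measure_empty]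
    exact ENNReal.zero_lt_top

theorem frameVolume_ne_zero (m n : ℕ) : frameVolume m n ≠ 0 := by
  obtain ⟨U, hU, h⟩ := exists_nhds_area_chart (m := m) (n := n) 0 (K := 2) (by norm_num)
  intro h0
  set B := U ∩ {v : ChartSpace m n | chart v ∈ orthFrames m n}
  have hB : B ∈ 𝓝 (chartPt 0 : ChartSpace m n) :=
    Filter.inter_mem hU (eventually_chart_mem_orthFrames 0)
  have h1 := (h B inter_subset_left).2
  have hsub : chart '' B ⊆ orthFrames m n := by
    rintro _ ⟨v, hv, rfl⟩
    exact hv.2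
  rw [← frameVolume_apply_of_subset hsub, h0, Measure.coe_zero, Pi.zero_apply, mul_zero,
    nonpos_iff_eq_zero, mul_eq_zero, ENNReal.ofReal_eq_zero] at h1
  rcases h1 with h1 | h1
  · exact absurd (chartJacobian_pos m) (not_lt.2 h1)
  · exact (Measure.measure_pos_of_mem_nhds _ hB).ne' h1

theorem isCompact_orthFrames_inter {m n : ℕ} {K : Set (Fin n → Fin m → ℝ)} (hK : IsCompact K) :
    IsCompact (orthFrames m n ∩ eigs ⁻¹' K) := by
  have hc : Continuous fun p : (Fin m → Fin m → ℝ) × (Fin n → Fin m → ℝ) =>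
      (mkFrame (Matrix.of p.1) p.2 : FrameSpace m n) := by
    refine (PiLp.continuous_toLp 2 _).comp (continuous_pi ?_)
    rintro (p | p)
    · simp only [Sum.elim_inl, Matrix.of_apply]; fun_prop
    · simp only [Sum.elim_inr]; fun_prop
  have hcomp : IsCompact ((fun p : (Fin m → Fin m → ℝ) × (Fin n → Fin m → ℝ) =>
      (mkFrame (Matrix.of p.1) p.2 : FrameSpace m n)) ''
      ((Set.univ.pi fun _ => Set.univ.pi fun _ => Icc (-1 : ℝ) 1) ×ˢ K)) :=
    ((isCompact_univ_pi fun _ => isCompact_univ_pi fun _ => isCompact_Icc).prod hK).image hc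
  refine hcomp.of_isClosed_subset
    ((isClosed_orthFrames m n).inter (hK.isClosed.preimage (continuous_eigs m n))) ?_
  rintro z ⟨hz, hzK⟩
  refine ⟨(fun j k => frame z j k, eigs z), ⟨fun j _ k _ => ?_, hzK⟩, mkFrame_frame_eigs z⟩
  have : ‖frame z j k‖ ≤ 1 := entry_norm_bound_of_unitary hz j k
  exact abs_le.1 this

/-- The coordinates `(Q, l)`. -/
def frameCoords {m n : ℕ} (z : FrameSpace m n) : (Fin m → Fin m → ℝ) × (Fin n → Fin m → ℝ) :=
  (fun j k => frame z j k, eigs z)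

theorem measurable_frameCoords (m n : ℕ) :
    Measurable (frameCoords : FrameSpace m n → _) := by
  refine Continuous.measurable (Continuous.prodMk ?_ (continuous_eigs m n))
  exact continuous_pi fun j => continuous_pi fun k => (continuous_frame m n).matrix_elem j k

/-- The unit cube. -/
def unitCube (m n : ℕ) : Set (Fin n → Fin m → ℝ) :=
  Set.univ.pi fun _ => Set.univ.pi fun _ => Icc 0 1

theorem isCompact_unitCube (m n : ℕ) : IsCompact (unitCube m n) :=
  isCompact_univ_pi fun _ => isCompact_univ_pi fun _ => isCompact_Icc

theorem volume_unitCube (m n : ℕ) : volume (unitCube m n) = 1 := by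
  rw [unitCube, volume_pi_pi]
  simp only [volume_pi_pi, Real.volume_Icc]
  simp

/-- The measure on the orthogonal group (as a measure on all square matrices) obtained from
`frameVolume` by restricting the joint eigenvalues to the unit cube. -/
def orthVolume (m n : ℕ) : Measure (Fin m → Fin m → ℝ) :=
  (((frameVolume m n).map frameCoords).restrict (Set.univ ×ˢ unitCube m n)).map Prod.fst

theorem orthVolume_apply {m n : ℕ} {s : Set (Fin m → Fin m → ℝ)} (hs : MeasurableSet s) :
    orthVolume m n s = ((frameVolume m n).map frameCoords) (s ×ˢ unitCube m n) := by
  rw [orthVolume, Measure.map_apply measurable_fst hs,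
    Measure.restrict_apply (measurable_fst hs)]
  congr 1
  ext p
  simp

theorem map_frameCoords_lt_top {m n : ℕ} (s : Set (Fin m → Fin m → ℝ))
    {K : Set (Fin n → Fin m → ℝ)} (hK : IsCompact K) :
    ((frameVolume m n).map frameCoords) (s ×ˢ K) < ⊤ := by
  refine (measure_mono (prod_mono_left (subset_univ s))).trans_lt ?_
  rw [Measure.map_apply (measurable_frameCoords m n) (MeasurableSet.univ.prod hK.measurableSet),
    ← frameVolume_inter_orthFrames]
  refine lt_of_le_of_lt (measure_mono ?_) (isCompact_orthFrames_inter hK).measure_lt_top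
  rintro z ⟨hz, hzo⟩
  exact ⟨hzo, hz.2⟩

instance (m n : ℕ) : IsFiniteMeasure (orthVolume m n) := by
  refine ⟨?_⟩
  rw [orthVolume_apply MeasurableSet.univ]
  exact map_frameCoords_lt_top _ (isCompact_unitCube m n)

/-- The translation of the joint eigenvalues preserves the volume, since it is an isometry. -/
theorem frameVolume_translate {m n : ℕ} (l : Fin n → Fin m → ℝ) (B : Set (FrameSpace m n)) :
    frameVolume m n ((fun z => mkFrame 0 l + z) ⁻¹' B) = frameVolume m n B := by
  have h : ∀ z : FrameSpace m n, mkFrame 0 l + z ∈ orthFrames m n ↔ z ∈ orthFrames m n := by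
    intro z
    have : frame (mkFrame 0 l + z) = frame z := by
      change (0 : Matrix (Fin m) (Fin m) ℝ) + frame z = frame z
      rw [zero_add]
    simp only [orthFrames, mem_ofPred_eq, this]
  rw [frameVolume, Measure.restrict_apply' (isClosed_orthFrames m n).measurableSet,
    Measure.restrict_apply' (isClosed_orthFrames m n).measurableSet,
    show (fun z => mkFrame 0 l + z) ⁻¹' B ∩ orthFrames m n =
      (fun z => mkFrame 0 l + z) ⁻¹' (B ∩ orthFrames m n) from by ext z; simp [h],
    measure_preimage_add]

/-- The volume of the space of pairs `(Q, l)` is a product measure: it is invariant under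
translations of `l`, and Lebesgue measure is the only such measure up to a constant. -/
theorem map_frameCoords_frameVolume (m n : ℕ) :
    (frameVolume m n).map frameCoords = (orthVolume m n).prod volume := by
  refine (Measure.prod_eq fun s t hs ht => ?_).symm
  -- for fixed `s`, the measure `t ↦ ρ (s × t)` on joint eigenvalues is translation invariant
  set κ : Measure (Fin n → Fin m → ℝ) :=
    (((frameVolume m n).map frameCoords).restrict (s ×ˢ Set.univ)).map Prod.snd with hκ
  have hκ_apply : ∀ t, MeasurableSet t →
      κ t = ((frameVolume m n).map frameCoords) (s ×ˢ t) := by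
    intro t ht
    rw [hκ, Measure.map_apply measurable_snd ht, Measure.restrict_apply (measurable_snd ht)]
    congr 1
    ext p
    simp [and_comm]
  have h1 : IsFiniteMeasureOnCompacts κ := ⟨fun K hK => by
    rw [hκ_apply K hK.measurableSet]
    exact map_frameCoords_lt_top s hK⟩
  have h2 : κ.IsAddLeftInvariant := by
    refine ⟨fun l => Measure.ext fun t ht => ?_⟩
    have ht' : MeasurableSet ((fun x => l + x) ⁻¹' t) := measurable_const_add l ht
    rw [Measure.map_apply (measurable_const_add l) ht, hκ_apply _ ht', hκ_apply _ ht,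
      Measure.map_apply (measurable_frameCoords m n) (hs.prod ht'),
      Measure.map_apply (measurable_frameCoords m n) (hs.prod ht),
      ← frameVolume_translate l (frameCoords ⁻¹' s ×ˢ t)]
    congr 1
    ext z
    have h3 : frameCoords (mkFrame 0 l + z) = ((frameCoords z).1, l + (frameCoords z).2) := by
      refine Prod.ext ?_ rfl
      funext j k
      change (0 : ℝ) + frame z j k = frame z j k
      rw [zero_add]
    simp [h3]
  have h3 : (volume : Measure (Fin n → Fin m → ℝ)).IsAddHaarMeasure :=
    Measure.pi.isAddHaarMeasure fun _ : Fin n => (volume : Measure (Fin m → ℝ))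
  have h4 := Measure.isAddLeftInvariant_eq_smul κ (volume : Measure (Fin n → Fin m → ℝ))
  have h5 : orthVolume m n s = κ.addHaarScalarFactor volume := by
    rw [orthVolume_apply hs, ← hκ_apply _ (isCompact_unitCube m n).measurableSet]
    conv_lhs => rw [h4]
    rw [Measure.smul_apply, volume_unitCube, ENNReal.smul_def, smul_eq_mul, mul_one]
  rw [← hκ_apply t ht, h5]
  conv_lhs => rw [h4]
  rw [Measure.smul_apply, ENNReal.smul_def, smul_eq_mul]

theorem orthVolume_ne_zero (m n : ℕ) : orthVolume m n ≠ 0 := by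
  intro h
  have := map_frameCoords_frameVolume m n
  rw [h, Measure.zero_prod,
    Measure.map_eq_zero_iff (measurable_frameCoords m n).aemeasurable] at this
  exact frameVolume_ne_zero m n this

theorem ae_orthVolume_mem (m n : ℕ) :
    ∀ᵐ q ∂(orthVolume m n), Matrix.of q ∈ Matrix.orthogonalGroup (Fin m) ℝ := by
  have hcl : IsClosed {q : Fin m → Fin m → ℝ | Matrix.of q ∈ Matrix.orthogonalGroup (Fin m) ℝ} := by
    simp only [Matrix.mem_orthogonalGroup_iff]
    have hof : Continuous fun q : Fin m → Fin m → ℝ => (Matrix.of q : Matrix (Fin m) (Fin m) ℝ) :=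
      continuous_id
    exact isClosed_eq (by fun_prop) continuous_const
  rw [ae_iff]
  have hm : MeasurableSet {q : Fin m → Fin m → ℝ |
      ¬ Matrix.of q ∈ Matrix.orthogonalGroup (Fin m) ℝ} := hcl.isOpen_compl.measurableSet
  rw [orthVolume_apply hm, Measure.map_apply (measurable_frameCoords m n)
    (hm.prod (isCompact_unitCube m n).measurableSet), ← frameVolume_inter_orthFrames]
  convert measure_empty (μ := frameVolume m n)
  rw [Set.eq_empty_iff_forall_notMem]
  rintro z ⟨hz, hzo⟩
  exact hz.1 hzo

/-! ### The Jacobian of the spectral map -/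

/-- Near an orthonormal frame with distinct joint eigenvalues, `spectralMap` is injective with
Jacobian `jointVandermonde`. Rotating to `Q = 1`, this compares the area formulas of `chart` and of
`spectralMap ∘ chart`. -/
theorem exists_nhds_spectralMap_comparison {m n : ℕ} {z : FrameSpace m n} (hz : z ∈ orthFrames m n)
    (hV : jointVandermonde (eigs z) ≠ 0) {K : ℝ≥0} (hK : 1 < K) :
    ∃ W ∈ 𝓝 z, InjOn spectralMap (W ∩ orthFrames m n) ∧ ∀ B ⊆ W ∩ orthFrames m n,
      μHE[simDiagDim m n] (spectralMap '' B) ≤ (K : ℝ≥0∞) ^ (simDiagDim m n + simDiagDim m n) *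
        (ENNReal.ofReal (jointVandermonde (eigs z)) * frameVolume m n B) ∧
      ENNReal.ofReal (jointVandermonde (eigs z)) * frameVolume m n B ≤
        (K : ℝ≥0∞) ^ (simDiagDim m n + simDiagDim m n) *
          μHE[simDiagDim m n] (spectralMap '' B) := by
  set d := simDiagDim m n
  obtain ⟨U₁, hU₁, h₁⟩ := exists_nhds_area_chart (m := m) (eigs z) hK
  obtain ⟨U₂, hU₂, hinj, h₂⟩ := exists_nhds_area_spectralMap_chart hV hK
  obtain ⟨W, hW, hWU⟩ := exists_nhds_subset_image_chart (eigs z) (Filter.inter_mem hU₁ hU₂)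
  rw [← transpose_rotateFrame_eq hz] at hW
  set Q := (frame z).transpose
  have hQ : Q ∈ Matrix.orthogonalGroup (Fin m) ℝ := transpose_mem hz
  set R := rotateFrame (n := n) Q hQ with hR
  refine ⟨R ⁻¹' W, R.continuous.continuousAt hW, ?_, fun B hB => ?_⟩
  · intro x hx y hy hxy
    obtain ⟨v, hv, hvx⟩ := hWU ⟨hx.1, rotateFrame_mem_orthFrames hQ hx.2⟩
    obtain ⟨w, hw, hwy⟩ := hWU ⟨hy.1, rotateFrame_mem_orthFrames hQ hy.2⟩
    apply R.injective
    rw [← hvx, ← hwy, hinj hv.2 hw.2]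
    change spectralMap (chart v) = spectralMap (chart w)
    rw [hvx, hwy, spectralMap_rotateFrame, spectralMap_rotateFrame, hxy]
  · set B' := U₁ ∩ U₂ ∩ chart ⁻¹' (R '' B)
    have hB' : chart '' B' = R '' B := by
      rw [image_inter_preimage, inter_eq_right]
      rintro _ ⟨x, hx, rfl⟩
      exact hWU ⟨(hB hx).1, rotateFrame_mem_orthFrames hQ (hB hx).2⟩
    have e1 : μHE[d] (chart '' B') = frameVolume m n B := by
      rw [hB', R.isometry.euclideanHausdorffMeasure_image,
        frameVolume_apply_of_subset (hB.trans inter_subset_right)]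
    have e2 : μHE[d] ((fun v => spectralMap (chart v)) '' B') = μHE[d] (spectralMap '' B) := by
      rw [← image_image spectralMap chart, hB', image_image]
      simp only [hR, spectralMap_rotateFrame]
      rw [← image_image (conjTuple Q hQ) spectralMap,
        (conjTuple Q hQ).isometry.euclideanHausdorffMeasure_image]
    have h₁' := h₁ B' (inter_subset_left.trans inter_subset_left)
    have h₂' := h₂ B' (inter_subset_left.trans inter_subset_right)
    rw [e1] at h₁'
    rw [e2, mul_comm (chartJacobian m), ENNReal.ofReal_mul (jointVandermonde_nonneg _),
      mul_assoc] at h₂'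
    constructor
    · refine h₂'.1.trans ?_
      rw [pow_add, mul_assoc]
      refine mul_le_mul' le_rfl ?_
      rw [mul_left_comm ((K : ℝ≥0∞) ^ d)]
      exact mul_le_mul' le_rfl h₁'.2
    · calc ENNReal.ofReal (jointVandermonde (eigs z)) * frameVolume m n B
          ≤ ENNReal.ofReal (jointVandermonde (eigs z)) *
            ((K : ℝ≥0∞) ^ d * (ENNReal.ofReal (chartJacobian m) * volume B')) := by
            gcongr
            exact h₁'.1
        _ ≤ _ := by
            rw [pow_add, mul_assoc, mul_left_comm]
            exact mul_le_mul' le_rfl h₂'.2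

/-- The volume of the space of pairs `(Q, l)`, weighted by the Jacobian of the spectral map. -/
def weightedFrameVolume (m n : ℕ) : Measure (FrameSpace m n) :=
  (frameVolume m n).withDensity fun z => ENNReal.ofReal (jointVandermonde (eigs z))

theorem measurable_jointVandermonde_eigs (m n : ℕ) :
    Measurable fun z : FrameSpace m n => ENNReal.ofReal (jointVandermonde (eigs z)) :=
  ((continuous_jointVandermonde m n).comp (continuous_eigs m n)).measurable.ennreal_ofReal

/-- In `exists_nhds_spectralMap_comparison` the Jacobian at the centre may be replaced by the
variable density, since it is continuous. -/
theorem exists_nhds_weighted_comparison {m n : ℕ} {z : FrameSpace m n} (hz : z ∈ orthFrames m n)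
    (hV : jointVandermonde (eigs z) ≠ 0) {K : ℝ≥0} (hK : 1 < K) :
    ∃ W ∈ 𝓝 z, IsOpen W ∧ (∀ y ∈ W, jointVandermonde (eigs y) ≠ 0) ∧
      InjOn spectralMap (W ∩ orthFrames m n) ∧
      ∀ B ⊆ W ∩ orthFrames m n, MeasurableSet B →
      μHE[simDiagDim m n] (spectralMap '' B) ≤
        (K : ℝ≥0∞) ^ (simDiagDim m n + simDiagDim m n + 1) * weightedFrameVolume m n B ∧
      weightedFrameVolume m n B ≤ (K : ℝ≥0∞) ^ (simDiagDim m n + simDiagDim m n + 1) *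
          μHE[simDiagDim m n] (spectralMap '' B) := by
  set d := simDiagDim m n
  obtain ⟨W, hW, hinj, h⟩ := exists_nhds_spectralMap_comparison hz hV hK
  have hpos : 0 < jointVandermonde (eigs z) := (jointVandermonde_nonneg _).lt_of_ne' hV
  have hc : Continuous fun y : FrameSpace m n => jointVandermonde (eigs y) :=
    (continuous_jointVandermonde m n).comp (continuous_eigs m n)
  have hK1 : (1 : ℝ) < K := by exact_mod_cast hK
  have hev : ∀ᶠ y in 𝓝 z, jointVandermonde (eigs y) < K * jointVandermonde (eigs z) ∧
      jointVandermonde (eigs z) < K * jointVandermonde (eigs y) := by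
    refine (hc.continuousAt.eventually_lt continuousAt_const ?_).and
      (continuousAt_const.eventually_lt (hc.const_mul (K : ℝ)).continuousAt ?_) <;>
      nlinarith
  obtain ⟨W', hW's, hW'o, hzW'⟩ := mem_nhds_iff.1 (Filter.inter_mem hW hev)
  refine ⟨W', hW'o.mem_nhds hzW', hW'o, fun y hy => ?_,
    hinj.mono (inter_subset_inter_left _ fun y hy => (hW's hy).1), fun B hB hBm => ?_⟩
  · have := (hW's hy).2.2
    have hK0 : (0 : ℝ) < K := by linarith
    exact (pos_of_mul_pos_right (hpos.trans this) hK0.le).ne'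
  · have hB' := h B fun y hy => ⟨(hW's (hB hy).1).1, (hB hy).2⟩
    have hle1 : weightedFrameVolume m n B ≤
        K * (ENNReal.ofReal (jointVandermonde (eigs z)) * frameVolume m n B) := by
      rw [weightedFrameVolume, withDensity_apply _ hBm, ← mul_assoc, ← setLIntegral_const]
      refine setLIntegral_mono measurable_const fun y hy => ?_
      rw [← ENNReal.ofReal_coe_nnreal, ← ENNReal.ofReal_mul (by positivity)]
      exact ENNReal.ofReal_le_ofReal (hW's (hB hy).1).2.1.le
    have hle2 : ENNReal.ofReal (jointVandermonde (eigs z)) * frameVolume m n B ≤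
        K * weightedFrameVolume m n B := by
      rw [weightedFrameVolume, withDensity_apply _ hBm, ← setLIntegral_const,
        ← lintegral_const_mul _ (measurable_jointVandermonde_eigs m n)]
      refine setLIntegral_mono ((measurable_jointVandermonde_eigs m n).const_mul _) fun y hy => ?_
      rw [← ENNReal.ofReal_coe_nnreal, ← ENNReal.ofReal_mul (by positivity)]
      exact ENNReal.ofReal_le_ofReal (hW's (hB hy).1).2.2.le
    constructor
    · refine hB'.1.trans ?_
      rw [pow_succ _ (d + d), mul_assoc _ (K : ℝ≥0∞)]
      exact mul_le_mul' le_rfl hle2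
    · refine hle1.trans ?_
      rw [pow_succ' _ (d + d), mul_assoc (K : ℝ≥0∞)]
      exact mul_le_mul' le_rfl hB'.2

/-! ### The volume of the space of simultaneously diagonalizable tuples -/

/-- The image is σ-compact. -/
theorem measurableSet_image_of_isClosed {m n : ℕ} {C : Set (FrameSpace m n)} (hC : IsClosed C) :
    MeasurableSet (spectralMap '' C) := by
  obtain ⟨K, hK, hKC⟩ := isSigmaCompact_univ.of_isClosed_subset hC (subset_univ C)
  rw [← hKC, image_iUnion]
  exact MeasurableSet.iUnion fun k =>
    ((hK k).image (contDiff_spectralMap m n).continuous).isClosed.measurableSet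

theorem measurableSet_simDiag (m n : ℕ) : MeasurableSet (simDiag m n) := by
  rw [simDiag_eq_image]
  exact measurableSet_image_of_isClosed (isClosed_orthFrames m n)

/-- The tuples with at least one multiple joint eigenvalue. -/
def singularTuples (m n : ℕ) : Set (TupleSpace m n) :=
  spectralMap '' (orthFrames m n ∩ {z | jointVandermonde (eigs z) = 0})

theorem measurableSet_singularTuples (m n : ℕ) : MeasurableSet (singularTuples m n) :=
  measurableSet_image_of_isClosed ((isClosed_orthFrames m n).inter
    (isClosed_eq ((continuous_jointVandermonde m n).comp (continuous_eigs m n)) continuous_const))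

theorem jointVandermonde_eigs_signedPerm {m n : ℕ} (s : Equiv.Perm (Fin m) × (Fin m → ℤˣ))
    (z : FrameSpace m n) :
    jointVandermonde (eigs (signedPerm s z)) = jointVandermonde (eigs z) := by
  rw [eigs_signedPerm]
  exact jointVandermonde_perm (eigs z) s.1

/-- Multiplicity of joint eigenvalues does not depend on the diagonalization. -/
theorem jointVandermonde_eq_zero_of_mem_singularTuples {m n : ℕ} {z : FrameSpace m n}
    (hz : z ∈ orthFrames m n) (h : spectralMap z ∈ singularTuples m n) :
    jointVandermonde (eigs z) = 0 := by
  obtain ⟨w, ⟨hw, hw0⟩, hwz⟩ := h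
  by_contra hV
  obtain ⟨s, rfl⟩ := exists_eq_signedPerm hz hw hV hwz.symm
  rw [mem_ofPred_eq, jointVandermonde_eigs_signedPerm] at hw0
  exact hV hw0

theorem volume_eq_zero_of_eq {m n : ℕ} (i : Fin n) {j k : Fin m} (hjk : j ≠ k) :
    volume {l : Fin n → Fin m → ℝ | l i j = l i k} = 0 := by
  have h3 : (volume : Measure (Fin n → Fin m → ℝ)).IsAddHaarMeasure :=
    Measure.pi.isAddHaarMeasure fun _ : Fin n => (volume : Measure (Fin m → ℝ))
  let φ : (Fin n → Fin m → ℝ) →ₗ[ℝ] ℝ :=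
    { toFun := fun l => l i j - l i k
      map_add' := fun a b => by simp only [Pi.add_apply]; ring
      map_smul' := fun c a => by
        simp only [Pi.smul_apply, smul_eq_mul, RingHom.id_apply]; ring }
  have h := Measure.addHaar_submodule (volume : Measure (Fin n → Fin m → ℝ)) (LinearMap.ker φ) ?_
  · refine measure_mono_null (fun l hl => ?_) h
    exact LinearMap.mem_ker.2 (sub_eq_zero.2 hl)
  · intro htop
    have : φ (fun _ => Pi.single j 1) = 0 := by
      rw [← LinearMap.mem_ker, htop]; exact Submodule.mem_top
    simp [φ, hjk] at this

/-- Tuples with a multiple joint eigenvalue form a null set, because the pairs `(Q, l)` with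
`l · j = l · k` do. -/
theorem euclideanHausdorffMeasure_singularTuples (m n : ℕ) :
    μHE[simDiagDim m n] (singularTuples m n) = 0 := by
  have hsub : singularTuples m n ⊆ ⋃ p : {p : Fin m × Fin m // p.1 ≠ p.2},
      spectralMap '' (orthFrames m n ∩ {z | ∀ i, eigs z i p.1.1 = eigs z i p.1.2}) := by
    rintro _ ⟨z, ⟨hz, hz0⟩, rfl⟩
    have := mt jointVandermonde_ne_zero_iff.2 (not_not.2 hz0)
    push Not at this
    obtain ⟨j, k, hjk, h⟩ := this
    exact mem_iUnion.2 ⟨⟨(j, k), hjk⟩, z, ⟨hz, h⟩, rfl⟩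
  refine measure_mono_null hsub (measure_iUnion_null fun p => ?_)
  -- without matrices there is no equation `l i j = l i k` to use, but then the space of tuples is a
  -- point and the dimension is positive, since `m` is at least `2`
  rcases Nat.eq_zero_or_pos n with rfl | hn
  · have hpos : 0 < simDiagDim m 0 := by
      have hc : 0 < Fintype.card (Pairs m) := by
        rcases lt_or_gt_of_ne p.2 with h | h
        · exact Fintype.card_pos_iff.2 ⟨⟨_, h⟩⟩
        · exact Fintype.card_pos_iff.2 ⟨⟨(p.1.2, p.1.1), h⟩⟩
      rw [card_pairs] at hc
      rw [simDiagDim]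
      omega
    have := Measure.nullSingletonClass_hausdorff (TupleSpace m 0) (d := simDiagDim m 0)
      (by exact_mod_cast hpos)
    rw [Measure.euclideanHausdorffMeasure_def, Measure.smul_apply,
      (Set.subsingleton_of_subsingleton).measure_zero, smul_zero]
  · refine euclideanHausdorffMeasure_image_eq_zero (contDiff_spectralMap m n) ?_
    rw [← frameVolume_apply_of_subset inter_subset_left]
    have h0 : ((frameVolume m n).map frameCoords)
        (Set.univ ×ˢ {l | l ⟨0, hn⟩ p.1.1 = l ⟨0, hn⟩ p.1.2}) = 0 := by
      rw [map_frameCoords_frameVolume, Measure.prod_prod, volume_eq_zero_of_eq _ p.2, mul_zero]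
    refine measure_mono_null (fun z hz => ?_)
      (Measure.preimage_null_of_map_null (measurable_frameCoords m n).aemeasurable h0)
    exact ⟨mem_univ _, hz.2 _⟩

/-- Signed permutations are isometries which preserve the weight. -/
theorem weightedFrameVolume_preimage_signedPerm {m n : ℕ}
    (s : Equiv.Perm (Fin m) × (Fin m → ℤˣ)) {B : Set (FrameSpace m n)} (hB : MeasurableSet B) :
    weightedFrameVolume m n (signedPerm s ⁻¹' B) = weightedFrameVolume m n B := by
  let e := (signedPerm (n := n) s).toLinearIsometryEquiv rfl
  have he : ∀ z, e z = signedPerm s z := fun z => rfl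
  have hmp : MeasurePreserving (signedPerm (n := n) s) (frameVolume m n) (frameVolume m n) := by
    have h := (e.toIsometryEquiv.measurePreserving_euclideanHausdorffMeasure
      (simDiagDim m n)).restrict_preimage (isClosed_orthFrames m n).measurableSet
    have hpre : e.toIsometryEquiv ⁻¹' orthFrames m n = orthFrames m n := by
      ext z
      exact signedPerm_mem_orthFrames_iff s z
    rw [hpre] at h
    exact h
  have hm : MeasurableSet (signedPerm s ⁻¹' B) := hmp.measurable hB
  rw [weightedFrameVolume, withDensity_apply _ hm, withDensity_apply _ hB,
    ← hmp.setLIntegral_comp_preimage hB (measurable_jointVandermonde_eigs m n)]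
  simp only [jointVandermonde_eigs_signedPerm]

theorem weightedFrameVolume_inter_orthFrames {m n : ℕ} (B : Set (FrameSpace m n)) :
    weightedFrameVolume m n (B ∩ orthFrames m n) = weightedFrameVolume m n B := by
  refine measure_inter_conull' ?_
  refine withDensity_absolutelyContinuous _ _ (measure_mono_null (t := (orthFrames m n)ᶜ)
    (fun z hz => hz.2) ?_)
  rw [← frameVolume_inter_orthFrames, compl_inter_self, measure_empty]

/-- The number `2 ^ m * m!` of signed permutations, which is the degree of the spectral map. -/
def signedPermCount (m : ℕ) : ℕ := Fintype.card (Equiv.Perm (Fin m) × (Fin m → ℤˣ))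

theorem signedPermCount_ne_zero (m : ℕ) : signedPermCount m ≠ 0 := Fintype.card_ne_zero

/-- Over a set `B` of regular tuples on which the spectral map has a local section with values in
`W`, its preimage consists of the images of one sheet in `W` under the signed permutations. -/
theorem map_weightedFrameVolume_apply {m n : ℕ} {W : Set (FrameSpace m n)} (hW : MeasurableSet W)
    (hV : ∀ z ∈ W, jointVandermonde (eigs z) ≠ 0) (hinj : InjOn spectralMap (W ∩ orthFrames m n))
    {B : Set (TupleSpace m n)} (hB : MeasurableSet B)
    (hBW : B ⊆ spectralMap '' (W ∩ orthFrames m n)) :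
    (weightedFrameVolume m n).map spectralMap B =
      signedPermCount m * weightedFrameVolume m n (W ∩ orthFrames m n ∩ spectralMap ⁻¹' B) := by
  have hΦ : Measurable (spectralMap : FrameSpace m n → TupleSpace m n) :=
    (contDiff_spectralMap m n).continuous.measurable
  set A := W ∩ orthFrames m n ∩ spectralMap ⁻¹' B with hA
  have hAm : MeasurableSet A := (hW.inter (isClosed_orthFrames m n).measurableSet).inter (hΦ hB)
  have hunion : spectralMap ⁻¹' B ∩ orthFrames m n =
      ⋃ s : Equiv.Perm (Fin m) × (Fin m → ℤˣ), signedPerm s ⁻¹' A := by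
    ext z
    simp only [mem_inter_iff, mem_iUnion, mem_preimage, hA, spectralMap_signedPerm,
      signedPerm_mem_orthFrames_iff]
    constructor
    · rintro ⟨hzB, hz⟩
      obtain ⟨w, ⟨hwW, hw⟩, hwz⟩ := hBW hzB
      obtain ⟨t, rfl⟩ := exists_eq_signedPerm hw hz (hV w hwW) hwz
      obtain ⟨s, hs⟩ := exists_eq_signedPerm hz hw
        (by rw [jointVandermonde_eigs_signedPerm]; exact hV w hwW) hwz.symm
      exact ⟨s, ⟨hs ▸ hwW, hz⟩, hzB⟩
    · rintro ⟨s, ⟨-, hz⟩, hzB⟩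
      exact ⟨hzB, hz⟩
  have hdisj : Pairwise (Function.onFun Disjoint
      fun s : Equiv.Perm (Fin m) × (Fin m → ℤˣ) => signedPerm (n := n) s ⁻¹' A) := by
    intro s t hst
    refine Set.disjoint_left.2 fun z hzs hzt => hst ?_
    have hz : z ∈ orthFrames m n := (signedPerm_mem_orthFrames_iff s z).1 hzs.1.2
    refine signedPerm_injective_of_ne_zero hz ?_ (hinj hzs.1 hzt.1 ?_)
    · rw [← jointVandermonde_eigs_signedPerm s]
      exact hV _ hzs.1.1
    · rw [spectralMap_signedPerm, spectralMap_signedPerm]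
  rw [Measure.map_apply hΦ hB, ← weightedFrameVolume_inter_orthFrames, hunion,
    measure_iUnion hdisj fun s => (signedPerm (n := n) s).continuous.measurable hAm]
  simp only [weightedFrameVolume_preimage_signedPerm _ hAm]
  rw [tsum_fintype, Finset.sum_const, Finset.card_univ, nsmul_eq_mul, signedPermCount]

/-- Away from multiple joint eigenvalues, `spectralMap` is a covering with `signedPermCount m`
sheets and Jacobian `jointVandermonde`. -/
theorem map_weightedFrameVolume_of_subset_regular {m n : ℕ} {B : Set (TupleSpace m n)}
    (hB : MeasurableSet B)
    (hBs : B ⊆ spectralMap '' (orthFrames m n ∩ {z | jointVandermonde (eigs z) ≠ 0})) :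
    (weightedFrameVolume m n).map spectralMap B =
      ((signedPermCount m : ℝ≥0∞) • μHE[simDiagDim m n]) B := by
  have hΦ := (contDiff_spectralMap m n).continuous
  have key : ∀ z ∈ orthFrames m n ∩ {z | jointVandermonde (eigs z) ≠ 0}, ∀ K : ℝ≥0, 1 < K →
      ∃ W ∈ 𝓝 z, ∀ B ⊆ spectralMap '' (W ∩ orthFrames m n), MeasurableSet B →
        (weightedFrameVolume m n).map spectralMap B ≤
          (K : ℝ≥0∞) ^ (simDiagDim m n + simDiagDim m n + 1) *
            ((signedPermCount m : ℝ≥0∞) • μHE[simDiagDim m n]) B ∧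
        ((signedPermCount m : ℝ≥0∞) • μHE[simDiagDim m n]) B ≤
          (K : ℝ≥0∞) ^ (simDiagDim m n + simDiagDim m n + 1) *
            (weightedFrameVolume m n).map spectralMap B := by
    rintro z ⟨hz, hzV⟩ K hK
    obtain ⟨W, hW, hWo, hV, hinj, h⟩ := exists_nhds_weighted_comparison hz hzV hK
    refine ⟨W, hW, fun B hBW hB => ?_⟩
    have him : spectralMap '' (W ∩ orthFrames m n ∩ spectralMap ⁻¹' B) = B := by
      rw [image_inter_preimage, inter_eq_right.2 hBW]
    have h' := h (W ∩ orthFrames m n ∩ spectralMap ⁻¹' B) inter_subset_left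
      ((hWo.measurableSet.inter (isClosed_orthFrames m n).measurableSet).inter (hΦ.measurable hB))
    rw [him] at h'
    rw [map_weightedFrameVolume_apply hWo.measurableSet hV hinj hB hBW, Measure.smul_apply,
      smul_eq_mul, mul_left_comm _ (signedPermCount m : ℝ≥0∞),
      mul_left_comm _ (signedPermCount m : ℝ≥0∞)]
    exact ⟨mul_le_mul' le_rfl h'.2, mul_le_mul' le_rfl h'.1⟩
  apply le_antisymm
  · refine measure_le_of_forall_nhds hΦ (isClosed_orthFrames m n)
      (simDiagDim m n + simDiagDim m n + 1) (fun z hz K hK => ?_) hB hBs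
    obtain ⟨W, hW, h⟩ := key z hz K hK
    exact ⟨W, hW, fun B hBW hB => (h B hBW hB).1⟩
  · refine measure_le_of_forall_nhds hΦ (isClosed_orthFrames m n)
      (simDiagDim m n + simDiagDim m n + 1) (fun z hz K hK => ?_) hB hBs
    obtain ⟨W, hW, h⟩ := key z hz K hK
    exact ⟨W, hW, fun B hBW hB => (h B hBW hB).2⟩

/-- The change of variables `M = Q * Λ * Qᵀ` on the level of measures. -/
theorem map_spectralMap_weightedFrameVolume (m n : ℕ) :
    (weightedFrameVolume m n).map spectralMap =
      (signedPermCount m : ℝ≥0∞) • (μHE[simDiagDim m n]).restrict (simDiag m n) := by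
  have hΦ : Measurable (spectralMap : FrameSpace m n → TupleSpace m n) :=
    (contDiff_spectralMap m n).continuous.measurable
  ext B hB
  -- both sides ignore the singular tuples: the left one as the weight vanishes there
  set B' := B ∩ (simDiag m n \ singularTuples m n) with hB'
  have hB'm : MeasurableSet B' :=
    hB.inter ((measurableSet_simDiag m n).diff (measurableSet_singularTuples m n))
  have h1 : (weightedFrameVolume m n).map spectralMap B' =
      (weightedFrameVolume m n).map spectralMap B := by
    refine measure_inter_conull ?_
    rw [Measure.map_apply hΦ ((measurableSet_simDiag m n).diff
      (measurableSet_singularTuples m n)).compl, ← weightedFrameVolume_inter_orthFrames,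
      weightedFrameVolume, withDensity_apply_eq_zero (measurable_jointVandermonde_eigs m n)]
    convert measure_empty (μ := frameVolume m n)
    rw [Set.eq_empty_iff_forall_notMem]
    rintro z ⟨hz0, hz, hzo⟩
    have hmem : spectralMap z ∈ simDiag m n := by
      rw [simDiag_eq_image]
      exact mem_image_of_mem _ hzo
    have hs : spectralMap z ∈ singularTuples m n := by
      by_contra h
      exact hz ⟨hmem, h⟩
    apply hz0
    rw [jointVandermonde_eq_zero_of_mem_singularTuples hzo hs, ENNReal.ofReal_zero]
  have h2 : ((μHE[simDiagDim m n]).restrict (simDiag m n)) B = μHE[simDiagDim m n] B' := by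
    rw [Measure.restrict_apply hB, hB', ← inter_sdiff_assoc]
    exact (measure_sdiff_null (euclideanHausdorffMeasure_singularTuples m n)).symm
  rw [← h1, map_weightedFrameVolume_of_subset_regular hB'm, Measure.smul_apply, Measure.smul_apply,
    h2]
  rintro M ⟨-, hM, hMs⟩
  rw [simDiag_eq_image] at hM
  obtain ⟨z, hz, rfl⟩ := hM
  exact ⟨z, ⟨hz, fun h => hMs ⟨z, ⟨hz, h⟩, rfl⟩⟩, rfl⟩

theorem map_withDensity_comp {X Y : Type*} [MeasurableSpace X] [MeasurableSpace Y] {μ : Measure X}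
    {e : X → Y} (he : Measurable e) {w : Y → ℝ≥0∞} (hw : Measurable w) :
    (μ.withDensity fun x => w (e x)).map e = (μ.map e).withDensity w := by
  ext B hB
  rw [Measure.map_apply he hB, withDensity_apply _ (he hB), withDensity_apply _ hB,
    setLIntegral_map hB hw he]

theorem smul_measure_ne_zero {X : Type*} [MeasurableSpace X] {c : ℝ≥0} (hc : c ≠ 0)
    {μ : Measure X} (hμ : μ ≠ 0) : c • μ ≠ 0 := by
  intro h
  have h2 : c⁻¹ • c • μ = 0 := by rw [h, smul_zero]
  rw [smul_smul, inv_mul_cancel₀ hc, one_smul] at h2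
  exact hμ h2

/-- The measure on joint eigenvalues with density `jointVandermonde`. -/
def eigMeasure (m n : ℕ) : Measure (Fin n → Fin m → ℝ) :=
  volume.withDensity fun l => ENNReal.ofReal (jointVandermonde l)

instance (m n : ℕ) : SFinite (eigMeasure m n) :=
  inferInstanceAs (SFinite (volume.withDensity _))

theorem measurable_jointVandermonde (m n : ℕ) :
    Measurable (jointVandermonde : (Fin n → Fin m → ℝ) → ℝ) :=
  (continuous_jointVandermonde m n).measurable

/-- The weight depends on the joint eigenvalues only, so that the weighted volume is a product too.
-/
theorem map_frameCoords_weightedFrameVolume (m n : ℕ) :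
    (weightedFrameVolume m n).map frameCoords = (orthVolume m n).prod (eigMeasure m n) := by
  have hw : Measurable fun l : Fin n → Fin m → ℝ => ENNReal.ofReal (jointVandermonde l) :=
    (measurable_jointVandermonde m n).ennreal_ofReal
  have h := map_withDensity_comp (μ := frameVolume m n) (measurable_frameCoords m n)
    (hw.comp measurable_snd)
  rw [map_frameCoords_frameVolume, Function.comp_def, ← prod_withDensity_right hw] at h
  exact h

/-- The tuple `(q * diagonal (l i) * qᵀ)_i`. -/
def tupleOfCoords {m n : ℕ} (p : (Fin m → Fin m → ℝ) × (Fin n → Fin m → ℝ)) : TupleSpace m n :=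
  spectralMap (mkFrame (Matrix.of p.1) p.2)

theorem measurable_tupleOfCoords (m n : ℕ) :
    Measurable (tupleOfCoords : _ → TupleSpace m n) := by
  refine (contDiff_spectralMap m n).continuous.measurable.comp
    ((PiLp.continuous_toLp 2 _).comp (continuous_pi ?_)).measurable
  rintro (p | p)
  · simp only [Sum.elim_inl, Matrix.of_apply]; fun_prop
  · simp only [Sum.elim_inr]; fun_prop

/-- The Weyl formula as an identity of measures: the volume of the space of simultaneously
diagonalizable tuples is the image of a product measure on frames and joint eigenvalues. -/
theorem exists_restrict_simDiag_eq_map (m n : ℕ) :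
    ∃ ν : Measure (Fin m → Fin m → ℝ), IsFiniteMeasure ν ∧ ν ≠ 0 ∧
      (∀ᵐ q ∂ν, Matrix.of q ∈ Matrix.orthogonalGroup (Fin m) ℝ) ∧
      (μHE[simDiagDim m n]).restrict (simDiag m n) =
        (ν.prod (eigMeasure m n)).map tupleOfCoords := by
  set c : ℝ≥0 := (signedPermCount m : ℝ≥0)⁻¹ with hc
  have hc0 : c ≠ 0 := inv_ne_zero (Nat.cast_ne_zero.2 (signedPermCount_ne_zero m))
  have hc1 : (c : ℝ≥0∞) * (signedPermCount m : ℝ≥0∞) = 1 := by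
    rw [← ENNReal.coe_natCast, ← ENNReal.coe_mul, hc,
      inv_mul_cancel₀ (Nat.cast_ne_zero.2 (signedPermCount_ne_zero m)), ENNReal.coe_one]
  refine ⟨(c : ℝ≥0∞) • orthVolume m n, inferInstanceAs (IsFiniteMeasure (c • orthVolume m n)),
    smul_measure_ne_zero hc0 (orthVolume_ne_zero m n),
    Measure.ae_smul_measure (ae_orthVolume_mem m n) _, ?_⟩
  have h := map_spectralMap_weightedFrameVolume m n
  have h2 : (weightedFrameVolume m n).map spectralMap =
      ((orthVolume m n).prod (eigMeasure m n)).map tupleOfCoords := by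
    rw [← map_frameCoords_weightedFrameVolume,
      Measure.map_map (measurable_tupleOfCoords m n) (measurable_frameCoords m n)]
    congr 1
  rw [Measure.prod_smul_left, Measure.map_smul, ← h2, h, smul_smul, hc1, one_smul]

/-- If a measure is the image under `Ψ` of `ν` times a weighted measure, then functions depending
only on the second factor are integrated by integrating against the weight. -/
theorem weyl_of_map {X T Y : Type*} [MeasurableSpace X]
    [MeasurableSpace T] [MeasurableSpace Y] {μ : Measure X} {ν : Measure T} {ξ : Measure Y}
    [IsFiniteMeasure ν] [SFinite ξ] (hν : ν ≠ 0) {w : Y → ℝ} (hw : Measurable w)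
    (hw0 : ∀ y, 0 ≤ w y) {Ψ : T × Y → X} (hΨ : Measurable Ψ)
    (hμ : μ = (ν.prod (ξ.withDensity fun y => ENNReal.ofReal (w y))).map Ψ)
    {P : T → Prop} (hP : ∀ᵐ q ∂ν, P q) {f : X → ℝ} (hf : AEMeasurable f μ) {g : Y → ℝ}
    (hfg : ∀ q y, P q → f (Ψ (q, y)) = g y) :
    (Integrable f μ ↔ Integrable (fun y => g y * w y) ξ) ∧
      ∫ x, f x ∂μ = ν.real univ * ∫ y, g y * w y ∂ξ := by
  have hae : ∀ᵐ p ∂(ν.prod (ξ.withDensity fun y => ENNReal.ofReal (w y))), f (Ψ p) = g p.2 :=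
    (Measure.quasiMeasurePreserving_fst.ae hP).mono fun p hp => hfg p.1 p.2 hp
  have h1 := integrable_iff_and_integral_eq_of_map_prod hν hΨ.aemeasurable hμ hf hae
  have h2 := integrable_withDensity_ofReal_iff (ξ := ξ) hw hw0 g
  exact ⟨h1.1.trans h2.1, by rw [h1.2, h2.2]⟩

/-- If the image of the product of `ν` with a weighted measure is a Haar measure, then every Haar
measure `μ` is the image of such a product with a multiple of `ν`, by uniqueness of Haar measure. -/
theorem exists_weyl_of_isAddHaarMeasure_map {G T Y : Type*} [AddGroup G] [TopologicalSpace G]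
    [IsTopologicalAddGroup G] [LocallyCompactSpace G] [SecondCountableTopology G]
    [MeasurableSpace G] [BorelSpace G] [MeasurableSpace T] [MeasurableSpace Y]
    (μ : Measure G) [μ.IsAddHaarMeasure] {ν : Measure T} {ξ : Measure Y}
    [IsFiniteMeasure ν] [SFinite ξ] {w : Y → ℝ} (hw : Measurable w) (hw0 : ∀ y, 0 ≤ w y)
    {Ψ : T × Y → G} (hΨ : Measurable Ψ)
    (hhaar : ((ν.prod (ξ.withDensity fun y => ENNReal.ofReal (w y))).map Ψ).IsAddHaarMeasure)
    {P : T → Prop} (hP : ∀ᵐ q ∂ν, P q) :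
    ∃ C : ℝ, 0 < C ∧ ∀ f : G → ℝ, AEMeasurable f μ → ∀ g : Y → ℝ,
      (∀ q y, P q → f (Ψ (q, y)) = g y) →
      (Integrable f μ ↔ Integrable (fun y => g y * w y) ξ) ∧
        ∫ x, f x ∂μ = C * ∫ y, g y * w y ∂ξ := by
  set μ₀ := (ν.prod (ξ.withDensity fun y => ENNReal.ofReal (w y))).map Ψ with hμ₀
  have hν : ν ≠ 0 := by
    intro h
    have h0 : μ₀ = 0 := by rw [hμ₀, h, Measure.zero_prod, Measure.map_zero]
    exact NeZero.ne μ₀ h0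
  set c := μ.addHaarScalarFactor μ₀ with hc
  have hcpos : 0 < c := Measure.addHaarScalarFactor_pos_of_isAddHaarMeasure μ μ₀
  have hμ : μ = ((c • ν).prod (ξ.withDensity fun y => ENNReal.ofReal (w y))).map Ψ := by
    have h := Measure.isAddLeftInvariant_eq_smul μ μ₀
    rw [h, ← hc, ENNReal.smul_def, hμ₀, ← Measure.map_smul, ← Measure.prod_smul_left]
    rfl
  have hcν : c • ν ≠ 0 := smul_measure_ne_zero hcpos.ne' hν
  have : NeZero (c • ν) := ⟨hcν⟩
  exact ⟨(c • ν).real univ, measureReal_univ_pos, fun f hf g hfg =>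
    weyl_of_map hcν hw hw0 hΨ hμ (Measure.ae_smul_measure hP (c : ℝ≥0∞)) hf hfg⟩

/-- The Weyl formula for simultaneously diagonalizable tuples. -/
theorem simDiag_weyl (m n : ℕ) : ∃ C : ℝ, 0 < C ∧
    ∀ f : simDiag m n → ℝ, AEMeasurable f (simDiagVolume m n) →
      (∀ (Q : Matrix.orthogonalGroup (Fin m) ℝ) (M : simDiag m n), f (conj Q M) = f M) →
      (Integrable f (simDiagVolume m n) ↔
        Integrable (fun l : Fin n → Fin m → ℝ => f (diagTuple l) * jointVandermonde l)) ∧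
      ∫ M, f M ∂(simDiagVolume m n) =
        C * ∫ l : Fin n → Fin m → ℝ, f (diagTuple l) * jointVandermonde l := by
  obtain ⟨ν, hfin, hν, hP, hμ⟩ := exists_restrict_simDiag_eq_map m n
  have : NeZero ν := ⟨hν⟩
  refine ⟨ν.real univ, measureReal_univ_pos, fun f hf hinv => ?_⟩
  have hemb : MeasurableEmbedding (Subtype.val : simDiag m n → TupleSpace m n) :=
    MeasurableEmbedding.subtype_coe (measurableSet_simDiag m n)
  have hmap : (simDiagVolume m n).map Subtype.val =
      (μHE[simDiagDim m n]).restrict (simDiag m n) := by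
    rw [simDiagVolume, isometry_subtype_coe.map_euclideanHausdorffMeasure, Subtype.range_coe]
  -- the coordinates `q` need not be orthogonal, so `f` is extended to all tuples; the value outside
  -- is irrelevant, as almost all `q` are orthogonal
  set F : TupleSpace m n → ℝ := Function.extend Subtype.val f 0
  have hF : ∀ M : simDiag m n, F M.1 = f M := Subtype.val_injective.extend_apply f 0
  have hFf : F ∘ Subtype.val = f := funext hF
  have hFm : AEMeasurable F ((simDiagVolume m n).map Subtype.val) := by
    rw [hemb.aemeasurable_map_iff, hFf]
    exact hf
  have h := weyl_of_map hν (measurable_jointVandermonde m n) jointVandermonde_nonneg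
    (measurable_tupleOfCoords m n) (hmap.trans hμ) hP hFm (g := fun l => f (diagTuple l))
    fun q l hq => by
      rw [← hinv ⟨Matrix.of q, hq⟩ (diagTuple l)]
      exact hF (conj ⟨Matrix.of q, hq⟩ (diagTuple l))
  rw [hemb.integrable_map_iff, hFf, hemb.integral_map] at h
  simpa only [hF] using h

/-! ### Symmetric matrices -/

instance (N : ℕ) : SecondCountableTopology (symSpace N) :=
  (Topology.IsEmbedding.subtypeVal (p := fun A : Fin N → Fin N → ℝ =>
    Matrix.IsSymm (Matrix.of A))).secondCountableTopology

instance (m n : ℕ) : SecondCountableTopology (blockSymSpace m n) :=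
  (Topology.IsEmbedding.subtypeVal (p := fun A : (Fin m × Fin n) → (Fin m × Fin n) → ℝ =>
    Matrix.of A ∈ blockSymSpace m n)).secondCountableTopology

/-- A symmetric matrix as a tuple of length one. -/
def symToTuple (N : ℕ) : symSpace N →ₗ[ℝ] TupleSpace N 1 where
  toFun A := ofMats fun _ => A.1
  map_add' _ _ := rfl
  map_smul' _ _ := rfl

theorem isClosedEmbedding_symToTuple (N : ℕ) : Topology.IsClosedEmbedding (symToTuple N) := by
  refine LinearMap.isClosedEmbedding_of_injective (LinearMap.ker_eq_bot.2 fun A B h => ?_)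
  exact Subtype.ext (congrArg (fun M : TupleSpace N 1 => mat M 0) h)

instance (N : ℕ) : LocallyCompactSpace (symSpace N) :=
  (isClosedEmbedding_symToTuple N).locallyCompactSpace

/-- The symmetric matrix `q * diagonal l * qᵀ`. -/
def symOfCoords {N : ℕ} (p : (Fin N → Fin N → ℝ) × (Fin N → ℝ)) : symSpace N :=
  ⟨Matrix.of p.1 * Matrix.diagonal p.2 * (Matrix.of p.1).transpose, by
    change (Matrix.of p.1 * Matrix.diagonal p.2 * (Matrix.of p.1).transpose).transpose = _
    rw [Matrix.transpose_mul, Matrix.transpose_mul, Matrix.transpose_transpose,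
      Matrix.diagonal_transpose, Matrix.mul_assoc]⟩

theorem measurable_symOfCoords (N : ℕ) : Measurable (symOfCoords : _ → symSpace N) := by
  have hof : Continuous fun q : Fin N → Fin N → ℝ => (Matrix.of q : Matrix (Fin N) (Fin N) ℝ) :=
    continuous_id
  refine Continuous.measurable (Continuous.subtype_mk ?_ _)
  fun_prop

theorem charpoly_symOfCoords {N : ℕ} {q : Fin N → Fin N → ℝ}
    (hq : Matrix.of q ∈ Matrix.orthogonalGroup (Fin N) ℝ) (l : Fin N → ℝ) :
    (symOfCoords (q, l)).1.charpoly = (symDiagonal l).1.charpoly := by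
  change (Matrix.of q * Matrix.diagonal l * (Matrix.of q).transpose).charpoly =
    (Matrix.diagonal l).charpoly
  rw [Matrix.charpoly_mul_comm, ← Matrix.mul_assoc, transpose_mul_of_mem hq, Matrix.one_mul]

/-- The Vandermonde weight of a spectrum. -/
def vandermondeWeight {N : ℕ} (l : Fin N → ℝ) : ℝ :=
  ∏ p : Fin N × Fin N with p.1 < p.2, |l p.1 - l p.2|

theorem vandermondeWeight_nonneg {N : ℕ} (l : Fin N → ℝ) : 0 ≤ vandermondeWeight l :=
  Finset.prod_nonneg fun _ _ => abs_nonneg _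

theorem continuous_vandermondeWeight (N : ℕ) :
    Continuous (vandermondeWeight : (Fin N → ℝ) → ℝ) := by
  unfold vandermondeWeight
  fun_prop

/-- For a single matrix the weight is the absolute value of the Vandermonde determinant. -/
theorem jointVandermonde_one {N : ℕ} (l : Fin N → ℝ) :
    jointVandermonde (fun _ : Fin 1 => l) = vandermondeWeight l := by
  refine Finset.prod_congr rfl fun p _ => ?_
  rw [EuclideanSpace.norm_eq, Fin.sum_univ_one, Real.norm_eq_abs, sq_abs, Real.sqrt_sq_eq_abs,
    abs_sub_comm]

/-- The measure on spectra with the Vandermonde density. -/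
def spectrumMeasure (N : ℕ) : Measure (Fin N → ℝ) :=
  volume.withDensity fun l => ENNReal.ofReal (vandermondeWeight l)

instance (N : ℕ) : SigmaFinite (spectrumMeasure N) :=
  SigmaFinite.withDensity_ofReal _

theorem spectrumMeasure_ne_zero (N : ℕ) : spectrumMeasure N ≠ 0 := by
  intro h
  have hm := (continuous_vandermondeWeight N).measurable.ennreal_ofReal
  rw [spectrumMeasure, withDensity_eq_zero_iff hm.aemeasurable] at h
  have h2 := (Continuous.ae_eq_iff_eq (volume : Measure (Fin N → ℝ))
    (ENNReal.continuous_ofReal.comp (continuous_vandermondeWeight N)) continuous_const).1 h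
  have h3 := congrFun h2 fun j => (j : ℝ)
  have h4 : 0 < vandermondeWeight fun j : Fin N => (j : ℝ) := by
    refine Finset.prod_pos fun p hp => abs_pos.2 (sub_ne_zero.2 ?_)
    have : p.1 < p.2 := (Finset.mem_filter.1 hp).2
    exact fun h => this.ne (Fin.ext (by simpa using h))
  exact absurd (ENNReal.ofReal_eq_zero.1 h3) (not_le.2 h4)

/-- For a single matrix, joint eigenvalues are spectra. -/
theorem map_spectrumMeasure (N : ℕ) :
    (spectrumMeasure N).map (fun l (_ : Fin 1) => l) = eigMeasure N 1 := by
  have hmp : MeasurePreserving (fun (l : Fin N → ℝ) (_ : Fin 1) => l) volume volume :=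
    (volume_preserving_funUnique (Fin 1) (Fin N → ℝ)).symm
  have h := map_withDensity_comp (μ := (volume : Measure (Fin N → ℝ))) hmp.measurable
    (measurable_jointVandermonde N 1).ennreal_ofReal
  rw [hmp.map_eq] at h
  simp only [jointVandermonde_one] at h
  exact h

/-- Joint eigenvalues are bounded by the Frobenius norm, so the spectral map is proper. -/
theorem abs_eigs_le_norm_spectralMap {m n : ℕ} {z : FrameSpace m n} (hz : z ∈ orthFrames m n)
    (i : Fin n) (j : Fin m) : |eigs z i j| ≤ ‖spectralMap z‖ := by
  have hQ : frame z ∈ Matrix.orthogonalGroup (Fin m) ℝ := hz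
  have h : spectralMap z = conjTuple (frame z) hQ (spectralMap (mkFrame 1 (eigs z))) := by
    rw [← spectralMap_rotateFrame]
    congr 1
    refine frameSpace_ext ?_ rfl
    rw [frame_rotateFrame, frame_mkFrame, Matrix.mul_one]
  rw [h, LinearIsometry.norm_map]
  have h2 := PiLp.norm_apply_le (spectralMap (mkFrame 1 (eigs z))) (i, j, j)
  rwa [spectralMap_apply, Finset.sum_eq_single j (by
    intro b _ hb
    simp [Matrix.one_apply_ne hb.symm]) (by simp), frame_mkFrame, Matrix.one_apply_eq, one_mul,
    mul_one, eigs_mkFrame, Real.norm_eq_abs] at h2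

/-- The volume of the simultaneously diagonalizable tuples is finite on compact sets, because its
pullback along the proper spectral map is. -/
theorem euclideanHausdorffMeasure_simDiag_inter_lt_top {m n : ℕ} {K : Set (TupleSpace m n)}
    (hK : IsCompact K) : μHE[simDiagDim m n] (K ∩ simDiag m n) < ⊤ := by
  have hΦ := (contDiff_spectralMap m n).continuous
  have hloc : IsLocallyFiniteMeasure (weightedFrameVolume m n) :=
    IsLocallyFiniteMeasure.withDensity_ofReal
      ((continuous_jointVandermonde m n).comp (continuous_eigs m n))
  obtain ⟨R, hR⟩ := hK.isBounded.exists_norm_le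
  have hcomp : IsCompact (orthFrames m n ∩ spectralMap ⁻¹' K) := by
    refine (isCompact_orthFrames_inter (m := m) (n := n) (K := Set.univ.pi fun _ => Set.univ.pi
      fun _ => Icc (-R) R) (isCompact_univ_pi fun _ => isCompact_univ_pi fun _ =>
        isCompact_Icc)).of_isClosed_subset ((isClosed_orthFrames m n).inter
        (hK.isClosed.preimage hΦ)) ?_
    rintro z ⟨hz, hzK⟩
    exact ⟨hz, fun i _ j _ => abs_le.1 ((abs_eigs_le_norm_spectralMap hz i j).trans (hR _ hzK))⟩
  have h1 : (weightedFrameVolume m n).map spectralMap K < ⊤ := by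
    rw [Measure.map_apply hΦ.measurable hK.measurableSet, ← weightedFrameVolume_inter_orthFrames,
      inter_comm]
    exact hcomp.measure_lt_top
  rw [map_spectralMap_weightedFrameVolume, Measure.smul_apply,
    Measure.restrict_apply hK.measurableSet, smul_eq_mul] at h1
  exact ENNReal.lt_top_of_mul_ne_top_right h1.ne (Nat.cast_ne_zero.2 (signedPermCount_ne_zero m))

/-- The image of the product measure on frames and spectra is a Haar measure on the symmetric
matrices: it corresponds to a Hausdorff measure, which is invariant under translations. -/
theorem exists_isAddHaarMeasure_map_symOfCoords (N : ℕ) :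
    ∃ ν : Measure (Fin N → Fin N → ℝ), IsFiniteMeasure ν ∧
      (∀ᵐ q ∂ν, Matrix.of q ∈ Matrix.orthogonalGroup (Fin N) ℝ) ∧
      ((ν.prod (spectrumMeasure N)).map symOfCoords).IsAddHaarMeasure := by
  obtain ⟨ν, hfin, hν, hP, hμ⟩ := exists_restrict_simDiag_eq_map N 1
  refine ⟨ν, hfin, hP, ?_⟩
  have hι := isClosedEmbedding_symToTuple N
  have hιm : MeasurableEmbedding (symToTuple N) := hι.measurableEmbedding
  set μ₀ := (ν.prod (spectrumMeasure N)).map symOfCoords with hμ₀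
  have hmap : μ₀.map (symToTuple N) =
      (μHE[simDiagDim N 1]).restrict (simDiag N 1) := by
    have hj : Measurable fun (l : Fin N → ℝ) (_ : Fin 1) => l := by fun_prop
    rw [hμ, ← map_spectrumMeasure, hμ₀, Measure.map_map hιm.measurable (measurable_symOfCoords N)]
    conv_rhs => rw [← Measure.map_id (μ := ν)]
    rw [Measure.map_prod_map _ _ measurable_id hj,
      Measure.map_map (measurable_tupleOfCoords N 1) (measurable_id.prodMap hj)]
    rfl
  have hrange : ∀ B : Set (symSpace N), symToTuple N '' B ⊆ simDiag N 1 := by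
    rintro B _ ⟨A, -, rfl⟩
    have hA : A.1.IsHermitian := by
      rw [Matrix.IsHermitian, Matrix.conjTranspose_eq_transpose_of_trivial]
      exact A.2
    refine ⟨hA.eigenvectorUnitary, hA.eigenvectorUnitary.2, fun _ => hA.eigenvalues, fun _ => ?_⟩
    have := hA.spectral_theorem
    rw [Unitary.conjStarAlgAut_apply] at this
    exact this
  have hμ₀_apply : ∀ B, MeasurableSet B → μ₀ B = μHE[simDiagDim N 1] (symToTuple N '' B) := by
    intro B hB
    have := hιm.map_apply μ₀ (symToTuple N '' B)
    rw [preimage_image_eq _ hι.injective, hmap,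
      Measure.restrict_apply (hιm.measurableSet_image.2 hB), inter_eq_left.2 (hrange B)] at this
    exact this.symm
  have h1 : IsFiniteMeasureOnCompacts μ₀ := ⟨fun K hK => by
    rw [hμ₀_apply K hK.measurableSet, ← inter_eq_left.2 (hrange K)]
    exact euclideanHausdorffMeasure_simDiag_inter_lt_top (hK.image hι.continuous)⟩
  have h2 : μ₀.IsAddLeftInvariant := by
    refine ⟨fun A => Measure.ext fun B hB => ?_⟩
    rw [Measure.map_apply (measurable_const_add A) hB, hμ₀_apply _ (measurable_const_add A hB),
      hμ₀_apply _ hB, ← measure_preimage_add _ (symToTuple N A) (symToTuple N '' B)]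
    congr 1
    ext M
    constructor
    · rintro ⟨B', hB', rfl⟩
      exact ⟨A + B', hB', map_add _ _ _⟩
    · rintro ⟨B', hB', h⟩
      refine ⟨-A + B', by simpa using hB', ?_⟩
      rw [map_add, map_neg, h, neg_add_cancel_left]
  have h3 : μ₀ ≠ 0 := by
    intro h0
    rw [hμ₀, Measure.map_eq_zero_iff (measurable_symOfCoords N).aemeasurable,
      ← Measure.measure_univ_eq_zero, ← univ_prod_univ, Measure.prod_prod, mul_eq_zero,
      Measure.measure_univ_eq_zero, Measure.measure_univ_eq_zero] at h0
    exact h0.elim hν (spectrumMeasure_ne_zero N)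
  have h4 := Measure.isAddLeftInvariant_eq_smul μ₀ Measure.addHaar
  rw [h4, ENNReal.smul_def]
  refine Measure.IsAddHaarMeasure.smul _ (fun h => h3 ?_) ENNReal.coe_ne_top
  rw [h4, ENNReal.coe_eq_zero.1 h, zero_smul]

/-- The Weyl formula for symmetric matrices. -/
theorem symSpace_weyl (N : ℕ) (μ : Measure (symSpace N)) [μ.IsAddHaarMeasure] :
    ∃ C : ℝ, 0 < C ∧
      ∀ f : symSpace N → ℝ, AEMeasurable f μ →
        (∀ A B : symSpace N, A.1.charpoly = B.1.charpoly → f A = f B) →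
        (Integrable f μ ↔
          Integrable (fun l : Fin N → ℝ => f (symDiagonal l) * vandermondeWeight l)) ∧
        ∫ M, f M ∂μ = C * ∫ l : Fin N → ℝ, f (symDiagonal l) * vandermondeWeight l := by
  obtain ⟨ν, hfin, hP, hhaar⟩ := exists_isAddHaarMeasure_map_symOfCoords N
  obtain ⟨C, hC, h⟩ := exists_weyl_of_isAddHaarMeasure_map μ
    (continuous_vandermondeWeight N).measurable vandermondeWeight_nonneg
    (measurable_symOfCoords N) hhaar hP
  exact ⟨C, hC, fun f hf hinv => h f hf _ fun q l hq => hinv _ _ (charpoly_symOfCoords hq l)⟩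

/-! ### Block-diagonal symmetric matrices -/

/-- Symmetric block-diagonal matrices are families of symmetric matrices. -/
def blockEquiv (m n : ℕ) : (Fin n → symSpace m) ≃+ blockSymSpace m n where
  toFun A := ⟨Matrix.blockDiagonal fun i => (A i).1, by
    refine ⟨?_, fun p q h => ?_⟩
    · change (Matrix.blockDiagonal fun i => (A i).1).transpose = _
      rw [Matrix.blockDiagonal_transpose]
      exact congrArg _ (funext fun i => (A i).2)
    · rw [Matrix.blockDiagonal_apply, if_neg h]⟩
  invFun A i := ⟨A.1.blockDiag i, by
    ext j k
    exact congrFun (congrFun A.2.1 (j, i)) (k, i)⟩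
  left_inv A := funext fun i =>
    Subtype.ext (congrFun (Matrix.blockDiag_blockDiagonal fun i => (A i).1) i)
  right_inv A := by
    refine Subtype.ext (Matrix.ext ?_)
    rintro ⟨p₁, p₂⟩ ⟨q₁, q₂⟩
    change Matrix.blockDiagonal (fun i => A.1.blockDiag i) (p₁, p₂) (q₁, q₂) = A.1 (p₁, p₂) (q₁, q₂)
    rw [Matrix.blockDiagonal_apply]
    split_ifs with h
    · obtain rfl : p₂ = q₂ := h
      rfl
    · exact (A.2.2 _ _ h).symm
  map_add' A B := Subtype.ext (Matrix.blockDiagonal_add (fun i => (A i).1) fun i => (B i).1)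

theorem blockDiag_blockEquiv {m n : ℕ} (A : Fin n → symSpace m) (i : Fin n) :
    (blockEquiv m n A).1.blockDiag i = (A i).1 :=
  congrFun (Matrix.blockDiag_blockDiagonal fun i => (A i).1) i

theorem continuous_blockEquiv (m n : ℕ) : Continuous (blockEquiv m n) := by
  have h : Continuous fun (A : Fin n → symSpace m) (i : Fin n) => (A i).1 :=
    continuous_pi fun i => continuous_subtype_val.comp (continuous_apply i)
  exact Continuous.subtype_mk h.matrix_blockDiagonal _

theorem continuous_blockEquiv_symm (m n : ℕ) : Continuous (blockEquiv m n).symm := by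
  have h : Continuous fun A : blockSymSpace m n => A.1.blockDiag :=
    continuous_subtype_val.matrix_blockDiag
  exact continuous_pi fun i => Continuous.subtype_mk ((continuous_apply i).comp h) _

/-- The Weyl formula for block-diagonal symmetric matrices. -/
theorem blockSymSpace_weyl (m n : ℕ) (μ : Measure (blockSymSpace m n)) [μ.IsAddHaarMeasure] :
    ∃ C : ℝ, 0 < C ∧
      ∀ f : blockSymSpace m n → ℝ, AEMeasurable f μ →
        (∀ A B : blockSymSpace m n,
          (∀ i, (A.1.blockDiag i).charpoly = (B.1.blockDiag i).charpoly) → f A = f B) →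
        (Integrable f μ ↔
          Integrable (fun l : Fin n → Fin m → ℝ => f (blockSymDiagonal l) *
            ∏ i, vandermondeWeight (l i))) ∧
        ∫ M, f M ∂μ =
          C * ∫ l : Fin n → Fin m → ℝ, f (blockSymDiagonal l) * ∏ i, vandermondeWeight (l i) := by
  obtain ⟨ν, hfin, hP, hhaar⟩ := exists_isAddHaarMeasure_map_symOfCoords m
  have hwm : Measurable fun l : Fin m → ℝ => ENNReal.ofReal (vandermondeWeight l) :=
    (continuous_vandermondeWeight m).measurable.ennreal_ofReal
  have hLC : LocallyCompactSpace (blockSymSpace m n) :=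
    (Homeomorph.mk (blockEquiv m n).toEquiv (continuous_blockEquiv m n)
      (continuous_blockEquiv_symm m n)).symm.isClosedEmbedding.locallyCompactSpace
  set Ψ : (Fin n → Fin m → Fin m → ℝ) × (Fin n → Fin m → ℝ) → blockSymSpace m n :=
    fun p => blockEquiv m n fun i => symOfCoords (p.1 i, p.2 i) with hΨ
  have hΨm : Measurable Ψ := by
    refine (continuous_blockEquiv m n).measurable.comp (measurable_pi_lambda _ fun i => ?_)
    exact (measurable_symOfCoords m).comp (by fun_prop)
  have hsf : SigmaFinite (((volume : Measure (Fin m → ℝ)).withDensity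
      fun l => ENNReal.ofReal (vandermondeWeight l))) :=
    SigmaFinite.withDensity_ofReal _
  have hpi : (Measure.pi fun _ : Fin n => (ν.prod (spectrumMeasure m)).map symOfCoords).map
      (blockEquiv m n) = ((Measure.pi fun _ : Fin n => ν).prod
        (volume.withDensity fun l => ENNReal.ofReal (∏ i, vandermondeWeight (l i)))).map Ψ := by
    have h1 : (Measure.pi fun _ : Fin n => spectrumMeasure m) =
        volume.withDensity fun l => ENNReal.ofReal (∏ i, vandermondeWeight (l i)) := by
      simp only [ENNReal.ofReal_prod_of_nonneg fun i _ => vandermondeWeight_nonneg _]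
      exact pi_withDensity hwm
    have h2 := (measurePreserving_arrowProdEquivProdArrow (Fin m → Fin m → ℝ) (Fin m → ℝ) (Fin n)
      (fun _ => ν) fun _ => spectrumMeasure m)
    rw [← Measure.pi_map_pi fun _ => (measurable_symOfCoords m).aemeasurable, ← h1, ← h2.map_eq,
      Measure.map_map hΨm h2.measurable, Measure.map_map (continuous_blockEquiv m n).measurable]
    · rfl
    · exact measurable_pi_lambda _ fun i => (measurable_symOfCoords m).comp (measurable_pi_apply i)
  have hhaar' : (((Measure.pi fun _ : Fin n => ν).prod
      (volume.withDensity fun l => ENNReal.ofReal (∏ i, vandermondeWeight (l i)))).map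
        Ψ).IsAddHaarMeasure := by
    rw [← hpi]
    exact (blockEquiv m n).isAddHaarMeasure_map _ (continuous_blockEquiv m n)
      (continuous_blockEquiv_symm m n)
  have hP' : ∀ᵐ q ∂(Measure.pi fun _ : Fin n => ν),
      ∀ i, Matrix.of (q i) ∈ Matrix.orthogonalGroup (Fin m) ℝ :=
    ae_all_iff.2 fun i => (Measure.quasiMeasurePreserving_eval _ i).ae hP
  obtain ⟨C, hC, h⟩ := exists_weyl_of_isAddHaarMeasure_map μ
    (Finset.measurable_prod _ fun i _ =>
      (continuous_vandermondeWeight m).measurable.comp (measurable_pi_apply i))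
    (fun l => Finset.prod_nonneg fun i _ => vandermondeWeight_nonneg _) hΨm hhaar' hP'
  refine ⟨C, hC, fun f hf hinv => h f hf _ fun q l hq => hinv _ _ fun i => ?_⟩
  rw [hΨ, blockDiag_blockEquiv, charpoly_symOfCoords (hq i)]
  exact congrArg Matrix.charpoly
    (Matrix.blockDiag_diagonal (fun p : Fin m × Fin n => l p.2 p.1) i).symm

end

end WeylFormula

theorem mainTheorem7 :
    -- simultaneously diagonalizable tuples
    (∀ m n : ℕ, ∃ C : ℝ, 0 < C ∧
      ∀ f : WeylFormula.simDiag m n → ℝ, AEMeasurable f (WeylFormula.simDiagVolume m n) →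
        (∀ (Q : Matrix.orthogonalGroup (Fin m) ℝ) (M : WeylFormula.simDiag m n),
          f (WeylFormula.conj Q M) = f M) →
        (Integrable f (WeylFormula.simDiagVolume m n) ↔
          Integrable (fun l : Fin n → Fin m → ℝ =>
            f (WeylFormula.diagTuple l) * WeylFormula.jointVandermonde l)) ∧
        ∫ M, f M ∂(WeylFormula.simDiagVolume m n) =
          C * ∫ l : Fin n → Fin m → ℝ,
            f (WeylFormula.diagTuple l) * WeylFormula.jointVandermonde l) ∧
    -- symmetric matrices
    (∀ (N : ℕ) (μ : Measure (WeylFormula.symSpace N)) [μ.IsAddHaarMeasure], ∃ C : ℝ, 0 < C ∧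
      ∀ f : WeylFormula.symSpace N → ℝ, AEMeasurable f μ →
        (∀ A B : WeylFormula.symSpace N, A.1.charpoly = B.1.charpoly → f A = f B) →
        (Integrable f μ ↔
          Integrable (fun l : Fin N → ℝ => f (WeylFormula.symDiagonal l) *
            ∏ p : Fin N × Fin N with p.1 < p.2, |l p.1 - l p.2|)) ∧
        ∫ M, f M ∂μ =
          C * ∫ l : Fin N → ℝ, f (WeylFormula.symDiagonal l) *
            ∏ p : Fin N × Fin N with p.1 < p.2, |l p.1 - l p.2|) ∧
    -- symmetric block-diagonal matrices
    (∀ (m n : ℕ) (μ : Measure (WeylFormula.blockSymSpace m n)) [μ.IsAddHaarMeasure],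
      ∃ C : ℝ, 0 < C ∧
      ∀ f : WeylFormula.blockSymSpace m n → ℝ, AEMeasurable f μ →
        (∀ A B : WeylFormula.blockSymSpace m n,
          (∀ i, (A.1.blockDiag i).charpoly = (B.1.blockDiag i).charpoly) → f A = f B) →
        (Integrable f μ ↔
          Integrable (fun l : Fin n → Fin m → ℝ => f (WeylFormula.blockSymDiagonal l) *
            ∏ i, ∏ p : Fin m × Fin m with p.1 < p.2, |l i p.1 - l i p.2|)) ∧
        ∫ M, f M ∂μ =
          C * ∫ l : Fin n → Fin m → ℝ, f (WeylFormula.blockSymDiagonal l) *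
            ∏ i, ∏ p : Fin m × Fin m with p.1 < p.2, |l i p.1 - l i p.2|) := by
  exact ⟨fun m n => WeylFormula.simDiag_weyl m n, fun N μ _ => WeylFormula.symSpace_weyl N μ,
    fun m n μ _ => WeylFormula.blockSymSpace_weyl m n μ⟩
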